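/- A (not necessarily unital) C*-algebra $A$ is called pseudomatricial if every sentence of the continuous logic of C*-algebras that takes the value $0$ in all matrix algebras $M_n(\mathbb{C})$, $n\ge 1$, takes the value $0$ in $A$. Here sentences are built from norms of $*$-polynomials by applying continuous functions $\mathbb{R}^k\to\mathbb{R}$ and by taking suprema and infima over the closed unit ball. A tracial state is a positive linear functional $\tau$ of norm one with $\tau(ab)=\tau(ba)$; projections $p,q$ are (Murray–von Neumann) equivalent if $p=v^*v$, $q=vv^*$ for some $v\in A$, and $p$ is subequivalent to $q$ if it is equivalent to a subprojection of $q$; a copy of $p$ is a projection in $A$ equivalent to $p$. For $d\ge 1$, a projection $q$ is an approximate $d$-th of $p$ if $p$ is the sum of $d$ equivalent projections, one of which is $q$, and fewer than $d$ minimal projections, all of them mutually orthogonal. Proposition. Let $A$ be a pseudomatricial C*-algebra. Then $A$ has a unique tracial state $\tau$, and the linear span of the projections of $A$ is norm dense in $A$. Moreover, the trace of a projection $p\in A$ is determined by orthogonal copies and approximate fractions in the following sense. (a) If $A$ contains $n$ mutually orthogonal copies of $p$, then $n\,\tau(p)\le 1$; if $A$ does not contain $n+1$ mutually orthogonal copies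 of $p$, then $(n+1)\,\tau(p)\ge 1$. (b) For every $d\ge1$ there is an approximate $d$-th of $p$, and if $A$ is infinite-dimensional, then $\tau(q)=\tau(p)/d$ for every approximate $d$-th $q$ of $p$. (c) $\tau(p)$ is the infimum of all $m/n$ with $m\ge0$, $n\ge1$ for which there is a projection $q\in A$ such that $A$ contains $n$ mutually orthogonal copies of $q$, and $p$ is the sum of $m$ mutually orthogonal projections each subequivalent to $q$. -/

import Mathlib

namespace ContLogic

/-- Terms of the language of C*-algebras in the variables `x₀, …, x₍ₙ₋₁₎`: the `*`-polynomials
(without a symbol for the unit, so that they make sense in every C*-algebra). -/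
inductive StarPoly (n : ℕ) : Type
  | var : Fin n → StarPoly n
  | zero : StarPoly n
  | add : StarPoly n → StarPoly n → StarPoly n
  | mul : StarPoly n → StarPoly n → StarPoly n
  | smul : ℂ → StarPoly n → StarPoly n
  | adj : StarPoly n → StarPoly n

/-- Formulas of continuous logic for C*-algebras with `n` free variables: norms of `*`-polynomials,
closed under continuous connectives `ℝᵏ → ℝ` and under suprema and infima over the closed
unit ball. The quantified variable is variable `0` of the formula under the quantifier. -/
inductive Formula : ℕ → Type
  | norm {n : ℕ} : StarPoly n → Formula n
  | conn {n k : ℕ} : C(Fin k → ℝ, ℝ) → (Fin k → Formula n) → Formula n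
  | sup {n : ℕ} : Formula (n + 1) → Formula n
  | inf {n : ℕ} : Formula (n + 1) → Formula n

/-- A sentence is a formula without free variables. -/
abbrev Sentence : Type := Formula 0

section Eval

variable {A : Type*} [NonUnitalCStarAlgebra A]

/-- The value of a `*`-polynomial at a tuple of elements of a C*-algebra. -/
def StarPoly.eval {n : ℕ} (v : Fin n → A) : StarPoly n → A
  | .var i => v i
  | .zero => 0
  | .add s t => s.eval v + t.eval v
  | .mul s t => s.eval v * t.eval v
  | .smul c t => c • t.eval v
  | .adj t => star (t.eval v)

/-- The value of a formula at a tuple of elements of a C*-algebra. The function of `x` under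
each supremum or infimum is bounded on the unit ball, since a formula is bounded on
bounded sets of tuples. -/
noncomputable def Formula.eval : {n : ℕ} → Formula n → (Fin n → A) → ℝ
  | _, .norm t, v => ‖t.eval v‖
  | _, .conn u φ, v => u (fun i => (φ i).eval v)
  | _, .sup φ, v => ⨆ x : Metric.closedBall (0 : A) 1, φ.eval (Fin.cons (x : A) v)
  | _, .inf φ, v => ⨅ x : Metric.closedBall (0 : A) 1, φ.eval (Fin.cons (x : A) v)

end Eval

/-- The value of a sentence in a C*-algebra. -/
noncomputable def Sentence.value (φ : Sentence) (A : Type*) [NonUnitalCStarAlgebra A] : ℝ :=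
  Formula.eval (A := A) φ Fin.elim0

open scoped Matrix.Norms.L2Operator in
/-- A C*-algebra is pseudomatricial if every sentence that is zero in all matrix algebras
`Mₙ(ℂ)`, `n ≥ 1` (with the operator norm), is zero in it. -/
def IsPseudomatricial (A : Type*) [NonUnitalCStarAlgebra A] : Prop :=
  ∀ φ : Sentence, (∀ n : ℕ, 0 < n → φ.value (Matrix (Fin n) (Fin n) ℂ) = 0) → φ.value A = 0

section Projections

variable {A : Type*} [NonUnitalCStarAlgebra A]

open scoped ComplexOrder in
/-- A tracial state: a positive linear functional of norm one with `τ (a b) = τ (b a)`. -/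
structure IsTracialState (τ : A →L[ℂ] ℂ) : Prop where
  nonneg : ∀ a : A, 0 ≤ τ (star a * a)
  norm_eq_one : ‖τ‖ = 1
  tracial : ∀ a b : A, τ (a * b) = τ (b * a)

/-- Murray-von Neumann equivalence of projections. -/
def MvNEquiv (p q : A) : Prop :=
  ∃ v : A, star v * v = p ∧ v * star v = q

/-- Murray-von Neumann subequivalence: `p` is equivalent to a subprojection of `q`. -/
def MvNLE (p q : A) : Prop :=
  ∃ v : A, star v * v = p ∧ q * (v * star v) = v * star v

/-- The algebra contains `n` mutually orthogonal projections equivalent to `p`. -/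
def HasOrthogonalCopies (n : ℕ) (p : A) : Prop :=
  ∃ e : Fin n → A, (∀ i, IsStarProjection (e i)) ∧ (∀ i j, i ≠ j → e i * e j = 0) ∧
    ∀ i, MvNEquiv p (e i)

/-- Minimal projections: nonzero, and with no subprojections other than `0` and `p`. -/
def IsMinimalProjection (p : A) : Prop :=
  IsStarProjection p ∧ p ≠ 0 ∧ ∀ q : A, IsStarProjection q → p * q = q → q = 0 ∨ q = p

/-- `q` is an approximate `d`-th of `p`: `p` is the sum of `d` equivalent projections, one of
them `q`, and of fewer than `d` minimal projections, all of them mutually orthogonal. -/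
def IsApproxFraction (d : ℕ) (q p : A) : Prop :=
  ∃ (k : ℕ) (e : Fin d → A) (m : Fin k → A), k < d ∧
    (∀ i, IsStarProjection (e i)) ∧ (∀ j, IsMinimalProjection (m j)) ∧
    (∀ i i', i ≠ i' → e i * e i' = 0) ∧ (∀ j j', j ≠ j' → m j * m j' = 0) ∧
    (∀ i j, e i * m j = 0) ∧
    (∀ i, MvNEquiv q (e i)) ∧ (∃ i, e i = q) ∧
    p = ∑ i, e i + ∑ j, m j

/-- `p` is covered by `m` copies of `q`: it is the sum of `m` mutually orthogonal projections,
each of them subequivalent to `q`. -/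
def IsCoveredByCopies (m : ℕ) (q p : A) : Prop :=
  ∃ e : Fin m → A, (∀ i, IsStarProjection (e i)) ∧ (∀ i j, i ≠ j → e i * e j = 0) ∧
    (∀ i, MvNLE (e i) q) ∧ p = ∑ i, e i

end Projections

end ContLogic

/-! Every property needed of $A$ is inherited from matrix algebras. A $\forall\exists$ or
$\exists\forall$ statement about contractions, expressed by a continuous function of norms of
$*$-polynomials, passes from all $M_N(\mathbb C)$ to $A$ up to an arbitrary $\varepsilon$
(`IsPseudomatricial.forall_exists`, `IsPseudomatricial.exists_forall`). An implication is encoded by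
a minimum, a conjunction by a maximum or a sum of positive parts, a finite disjunction by a minimum
or a product. Functional calculus makes projections, partial isometries and orthogonality stable
(`exists_partialIsometry_near`, `exists_orthogonal_near`), so approximate solutions in $A$ can be
corrected to exact ones.

This yields: a unit; comparability of projections; a minimal projection $f$ with $fAf=\mathbb C f$;
approximate $d$-ths of every projection; a uniform approximation of self-adjoint contractions by
combinations of two projections, which iterates to density of the span; and distance at least $1$
from the unit to the closed span $K$ of the commutators, because commutators of matrices have trace
zero.

The trace is the quotient map $A\to A/K\cong\mathbb C$. The distance bound makes the scalar of $x$
modulo $K$ unique and at most $\|x\|$ in modulus. For its existence it suffices to treat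
projections, by density. If $f$ has $n$ orthogonal copies for every $n$, it lies within $1/n$ of $K$
for every $n$, hence in $K$; so an approximate $n$-th $q$ of the unit satisfies $nq\equiv 1$ modulo
$K$, and by comparability any projection is a finite sum of copies of $q$ plus a remainder
subequivalent to $q$, hence within $1/n$ of $K$. Otherwise finitely many copies of $f$ add up to
$1$, and every projection is a sum of copies of $f$. Every tracial state kills $K$, which gives
uniqueness. The claims on traces of projections follow by counting in such packings. -/

namespace ContLogic

/-! ### Transfer of quantified norm conditions from matrix algebras. -/

section Transfer

variable {A : Type*} [NonUnitalCStarAlgebra A]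

@[simp] theorem StarPoly.eval_var {n : ℕ} (v : Fin n → A) (i : Fin n) :
    (StarPoly.var i).eval v = v i := rfl
@[simp] theorem StarPoly.eval_zero {n : ℕ} (v : Fin n → A) :
    (StarPoly.zero : StarPoly n).eval v = 0 := rfl
@[simp] theorem StarPoly.eval_add {n : ℕ} (v : Fin n → A) (s t : StarPoly n) :
    (s.add t).eval v = s.eval v + t.eval v := rfl
@[simp] theorem StarPoly.eval_mul {n : ℕ} (v : Fin n → A) (s t : StarPoly n) :
    (s.mul t).eval v = s.eval v * t.eval v := rfl
@[simp] theorem StarPoly.eval_smul {n : ℕ} (v : Fin n → A) (c : ℂ) (t : StarPoly n) :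
    (t.smul c).eval v = c • t.eval v := rfl
@[simp] theorem StarPoly.eval_adj {n : ℕ} (v : Fin n → A) (t : StarPoly n) :
    t.adj.eval v = star (t.eval v) := rfl

/-- The difference of two `*`-polynomials. -/
def StarPoly.sub {n : ℕ} (s t : StarPoly n) : StarPoly n := s.add (.smul (-1) t)

@[simp] theorem StarPoly.eval_sub {n : ℕ} (v : Fin n → A) (s t : StarPoly n) :
    (s.sub t).eval v = s.eval v - t.eval v := by
  simp [StarPoly.sub, sub_eq_add_neg]

/-- The sum of a finite family of `*`-polynomials. -/
noncomputable def StarPoly.sum {n : ℕ} {ι : Type*} [Fintype ι] (t : ι → StarPoly n) : StarPoly n :=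
  (Finset.univ.toList.map t).foldr StarPoly.add StarPoly.zero

@[simp] theorem StarPoly.eval_sum {n : ℕ} {ι : Type*} [Fintype ι] (v : Fin n → A)
    (t : ι → StarPoly n) : (StarPoly.sum t).eval v = ∑ i, (t i).eval v := by
  have h : ∀ l : List ι, ((l.map t).foldr StarPoly.add StarPoly.zero).eval v
      = (l.map fun i => (t i).eval v).sum := by
    intro l
    induction l with
    | nil => rfl
    | cons a l ih => simp [ih]
  rw [StarPoly.sum, h, Finset.sum_map_toList]

/-- `*`-polynomials are bounded on the unit ball. -/
theorem StarPoly.exists_bound {n : ℕ} (t : StarPoly n) :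
    ∃ C : ℝ, ∀ v : Fin n → A, (∀ i, ‖v i‖ ≤ 1) → ‖t.eval v‖ ≤ C := by
  induction t with
  | var i => exact ⟨1, fun v hv => hv i⟩
  | zero => exact ⟨0, fun v _ => by simp⟩
  | add s t hs ht =>
    obtain ⟨C, hC⟩ := hs
    obtain ⟨D, hD⟩ := ht
    exact ⟨C + D, fun v hv => (norm_add_le _ _).trans (add_le_add (hC v hv) (hD v hv))⟩
  | mul s t hs ht =>
    obtain ⟨C, hC⟩ := hs
    obtain ⟨D, hD⟩ := ht
    exact ⟨C * D, fun v hv => (norm_mul_le _ _).trans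
      (mul_le_mul (hC v hv) (hD v hv) (norm_nonneg _) ((norm_nonneg _).trans (hC v hv)))⟩
  | smul c t ht =>
    obtain ⟨D, hD⟩ := ht
    exact ⟨‖c‖ * D, fun v hv => (norm_smul_le _ _).trans
      (mul_le_mul_of_nonneg_left (hD v hv) (norm_nonneg _))⟩
  | adj t ht =>
    obtain ⟨D, hD⟩ := ht
    exact ⟨D, fun v hv => by simpa using hD v hv⟩

instance : Nonempty (Metric.closedBall (0 : A) 1) := ⟨⟨0, by simp⟩⟩

theorem norm_cons_le {n : ℕ} (x : Metric.closedBall (0 : A) 1) {v : Fin n → A}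
    (hv : ∀ i, ‖v i‖ ≤ 1) (i : Fin (n + 1)) :
    ‖(Fin.cons (x : A) v : Fin (n + 1) → A) i‖ ≤ 1 := by
  refine Fin.cases ?_ (fun i => ?_) i
  · exact mem_closedBall_zero_iff.mp x.2
  · simpa using hv i

/-- Formulas are bounded on the unit ball. -/
theorem Formula.exists_bound {n : ℕ} (φ : Formula n) :
    ∃ C : ℝ, ∀ v : Fin n → A, (∀ i, ‖v i‖ ≤ 1) → |φ.eval v| ≤ C := by
  induction φ with
  | norm t =>
    obtain ⟨C, hC⟩ := t.exists_bound (A := A)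
    exact ⟨C, fun v hv => by simpa [Formula.eval] using hC v hv⟩
  | @conn n k u φ ih =>
    choose C hC using ih
    have hK : IsCompact (Set.univ.pi fun i : Fin k => Set.Icc (-C i) (C i)) :=
      isCompact_univ_pi fun i => isCompact_Icc
    obtain ⟨D, hD⟩ := hK.exists_bound_of_continuousOn u.continuous.continuousOn
    exact ⟨D, fun v hv => hD _ fun i _ => abs_le.mp (hC i v hv)⟩
  | sup φ ih =>
    obtain ⟨C, hC⟩ := ih
    refine ⟨C, fun v hv => ?_⟩
    have h := fun x => abs_le.mp (hC _ (norm_cons_le x hv))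
    rw [Formula.eval, abs_le]
    exact ⟨(h ⟨0, by simp⟩).1.trans (le_ciSup (f := fun x : Metric.closedBall (0 : A) 1 =>
      φ.eval (Fin.cons (x : A) v)) ⟨C, by rintro _ ⟨x, rfl⟩; exact (h x).2⟩ _),
      ciSup_le fun x => (h x).2⟩
  | inf φ ih =>
    obtain ⟨C, hC⟩ := ih
    refine ⟨C, fun v hv => ?_⟩
    have h := fun x => abs_le.mp (hC _ (norm_cons_le x hv))
    rw [Formula.eval, abs_le]
    exact ⟨le_ciInf fun x => (h x).1, (ciInf_le (f := fun x : Metric.closedBall (0 : A) 1 =>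
      φ.eval (Fin.cons (x : A) v)) ⟨-C, by rintro _ ⟨x, rfl⟩; exact (h x).1⟩
      ⟨0, by simp⟩).trans (h _).2⟩

theorem Formula.bddAbove_range {n : ℕ} (φ : Formula (n + 1)) {v : Fin n → A}
    (hv : ∀ i, ‖v i‖ ≤ 1) :
    BddAbove (Set.range fun x : Metric.closedBall (0 : A) 1 => φ.eval (Fin.cons (x : A) v)) := by
  obtain ⟨C, hC⟩ := φ.exists_bound (A := A)
  exact ⟨C, by rintro _ ⟨x, rfl⟩; exact (abs_le.mp (hC _ (norm_cons_le x hv))).2⟩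

theorem Formula.bddBelow_range {n : ℕ} (φ : Formula (n + 1)) {v : Fin n → A}
    (hv : ∀ i, ‖v i‖ ≤ 1) :
    BddBelow (Set.range fun x : Metric.closedBall (0 : A) 1 => φ.eval (Fin.cons (x : A) v)) := by
  obtain ⟨C, hC⟩ := φ.exists_bound (A := A)
  exact ⟨-C, by rintro _ ⟨x, rfl⟩; exact (abs_le.mp (hC _ (norm_cons_le x hv))).1⟩

/-- The tuple `w` followed by the tuple `v`. -/
def join {X : Type*} {n m : ℕ} (v : Fin n → X) (w : Fin m → X) : Fin (n + m) → X := fun j =>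
  if h : (j : ℕ) < m then w ⟨j, h⟩ else v ⟨j - m, by omega⟩

theorem join_zero {X : Type*} {n : ℕ} (v : Fin n → X) (w : Fin 0 → X) : join v w = v := by
  funext j
  simp [join]

theorem join_succ {X : Type*} {n m : ℕ} (v : Fin n → X) (w : Fin (m + 1) → X) :
    join v w = (Fin.cons (w 0) (join v (Fin.tail w)) : Fin (n + m + 1) → X) := by
  funext j
  refine Fin.cases ?_ (fun i => ?_) j
  · simp [join]
  · simp [join, Fin.tail]

theorem norm_join_le {n m : ℕ} {v : Fin n → A} {w : Fin m → A} (hv : ∀ i, ‖v i‖ ≤ 1)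
    (hw : ∀ i, ‖w i‖ ≤ 1) (i : Fin (n + m)) : ‖join v w i‖ ≤ 1 := by
  unfold join
  split_ifs
  · exact hw _
  · exact hv _

/-- Iterated infima. -/
def Formula.infs {n : ℕ} : (m : ℕ) → Formula (n + m) → Formula n
  | 0, φ => φ
  | m + 1, φ => Formula.infs m φ.inf

/-- Iterated suprema. -/
def Formula.sups {n : ℕ} : (m : ℕ) → Formula (n + m) → Formula n
  | 0, φ => φ
  | m + 1, φ => Formula.sups m φ.sup

theorem Formula.eval_infs_le {n m : ℕ} (φ : Formula (n + m)) {v : Fin n → A} {w : Fin m → A}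
    (hv : ∀ i, ‖v i‖ ≤ 1) (hw : ∀ i, ‖w i‖ ≤ 1) : (φ.infs m).eval v ≤ φ.eval (join v w) := by
  induction m with
  | zero => rw [join_zero]; rfl
  | succ m ih =>
    refine (ih φ.inf (w := Fin.tail w) (fun i => hw _)).trans ?_
    rw [join_succ, Formula.eval]
    exact ciInf_le (φ.bddBelow_range (norm_join_le hv fun i => hw _)) ⟨w 0, by simpa using hw 0⟩

theorem Formula.exists_lt_of_eval_infs_lt {n m : ℕ} (φ : Formula (n + m)) {v : Fin n → A} {c : ℝ}
    (h : (φ.infs m).eval v < c) :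
    ∃ w : Fin m → A, (∀ i, ‖w i‖ ≤ 1) ∧ φ.eval (join v w) < c := by
  induction m with
  | zero => exact ⟨Fin.elim0, fun i => i.elim0, by rwa [join_zero]⟩
  | succ m ih =>
    obtain ⟨w, hw, hlt⟩ := ih φ.inf h
    rw [Formula.eval] at hlt
    obtain ⟨x, hx⟩ := exists_lt_of_ciInf_lt hlt
    exact ⟨Fin.cons (x : A) w, norm_cons_le x hw, by rw [join_succ]; simpa using hx⟩

theorem Formula.le_eval_sups {n m : ℕ} (φ : Formula (n + m)) {v : Fin n → A} {w : Fin m → A}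
    (hv : ∀ i, ‖v i‖ ≤ 1) (hw : ∀ i, ‖w i‖ ≤ 1) : φ.eval (join v w) ≤ (φ.sups m).eval v := by
  induction m with
  | zero => rw [join_zero]; rfl
  | succ m ih =>
    refine le_trans ?_ (ih φ.sup (w := Fin.tail w) (fun i => hw _))
    rw [join_succ, Formula.eval]
    exact le_ciSup (φ.bddAbove_range (norm_join_le hv fun i => hw _)) ⟨w 0, by simpa using hw 0⟩

theorem Formula.eval_sups_le {n m : ℕ} (φ : Formula (n + m)) {v : Fin n → A} {c : ℝ}
    (h : ∀ w : Fin m → A, (∀ i, ‖w i‖ ≤ 1) → φ.eval (join v w) ≤ c) :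
    (φ.sups m).eval v ≤ c := by
  induction m with
  | zero =>
    have := h Fin.elim0 (fun i => i.elim0)
    rwa [join_zero] at this
  | succ m ih =>
    refine ih φ.sup fun w hw => ?_
    rw [Formula.eval]
    refine ciSup_le fun x => ?_
    have := h (Fin.cons (x : A) w) (norm_cons_le x hw)
    rw [join_succ] at this
    simpa using this

/-- A continuous function of the norms of finitely many `*`-polynomials. -/
noncomputable def Formula.ofNorms {n : ℕ} {J : Type*} [Fintype J] (u : (J → ℝ) → ℝ)
    (hu : Continuous u) (t : J → StarPoly n) : Formula n :=
  .conn (k := Fintype.card J) ⟨fun r => u fun j => r (Fintype.equivFin J j), by fun_prop⟩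
    fun i => .norm (t ((Fintype.equivFin J).symm i))

theorem Formula.eval_ofNorms {n : ℕ} {J : Type*} [Fintype J] (u : (J → ℝ) → ℝ)
    (hu : Continuous u) (t : J → StarPoly n) (v : Fin n → A) :
    (Formula.ofNorms u hu t).eval v = u fun j => ‖(t j).eval v‖ := by
  simp [Formula.ofNorms, Formula.eval]

variable (ι κ : Type) [Fintype ι] [Fintype κ]

/-- `*`-polynomials in two families of variables, indexed by `ι` and `κ`. -/
abbrev Poly₂ : Type := StarPoly (0 + Fintype.card ι + Fintype.card κ)

variable {ι κ}

/-- The assignment of values to two families of variables. -/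
noncomputable def assign {X : Type*} (x : ι → X) (y : κ → X) :
    Fin (0 + Fintype.card ι + Fintype.card κ) → X :=
  join (join Fin.elim0 (x ∘ (Fintype.equivFin ι).symm)) (y ∘ (Fintype.equivFin κ).symm)

variable (κ) in
/-- A variable of the first family. -/
noncomputable def fstVar (i : ι) : Poly₂ ι κ :=
  .var ⟨Fintype.card κ + Fintype.equivFin ι i, by omega⟩

variable (ι) in
/-- A variable of the second family. -/
noncomputable def sndVar (k : κ) : Poly₂ ι κ :=
  .var ⟨Fintype.equivFin κ k, by omega⟩

@[simp] theorem eval_fstVar (x : ι → A) (y : κ → A) (i : ι) :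
    (fstVar κ i).eval (assign x y) = x i := by
  simp [fstVar, assign, join]

@[simp] theorem eval_sndVar (x : ι → A) (y : κ → A) (k : κ) :
    (sndVar ι k).eval (assign x y) = y k := by
  simp [sndVar, assign, join]

/-- The connective `max 0`. -/
noncomputable def Formula.pos (φ : Sentence) : Sentence :=
  .conn (k := 1) ⟨fun r => max 0 (r 0), by fun_prop⟩ fun _ => φ

theorem Formula.eval_pos (φ : Sentence) :
    Sentence.value (Formula.pos φ) A = max 0 (Sentence.value φ A) := by
  simp [Sentence.value, Formula.pos, Formula.eval]

open scoped Matrix.Norms.L2Operator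

/-- Composing with $\max(0,\cdot)$ turns an inequality into the vanishing condition of the
definition. -/
theorem IsPseudomatricial.value_le (hA : IsPseudomatricial A) (φ : Sentence)
    (h : ∀ N : ℕ, 0 < N → φ.value (Matrix (Fin N) (Fin N) ℂ) ≤ 0) : φ.value A ≤ 0 := by
  have := hA (Formula.pos φ) fun N hN => by rw [Formula.eval_pos]; exact max_eq_left (h N hN)
  rw [Formula.eval_pos] at this
  exact max_eq_left_iff.mp this

/-- Transfer of `∀∃` statements from matrix algebras. -/
theorem IsPseudomatricial.forall_exists (hA : IsPseudomatricial A) {J : Type*} [Fintype J]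
    (t : J → Poly₂ ι κ) (u : (J → ℝ) → ℝ) (hu : Continuous u)
    (h : ∀ N : ℕ, 0 < N → ∀ x : ι → Matrix (Fin N) (Fin N) ℂ, (∀ i, ‖x i‖ ≤ 1) →
      ∃ y : κ → Matrix (Fin N) (Fin N) ℂ, (∀ k, ‖y k‖ ≤ 1) ∧
        u (fun j => ‖(t j).eval (assign x y)‖) ≤ 0)
    {ε : ℝ} (hε : 0 < ε) (x : ι → A) (hx : ∀ i, ‖x i‖ ≤ 1) :
    ∃ y : κ → A, (∀ k, ‖y k‖ ≤ 1) ∧ u (fun j => ‖(t j).eval (assign x y)‖) < ε := by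
  -- The sentence is $\sup_x\inf_y u$. Infima need not be attained in $A$, which is why the
  -- conclusion is only $<\varepsilon$.
  have key := hA.value_le (((Formula.ofNorms u hu t).infs _).sups _) fun N hN => by
    refine Formula.eval_sups_le _ fun w hw => ?_
    obtain ⟨y, hy, hle⟩ := h N hN (w ∘ Fintype.equivFin ι) (fun i => hw _)
    refine le_trans (Formula.eval_infs_le _ (norm_join_le (fun i => i.elim0) hw)
      (w := y ∘ (Fintype.equivFin κ).symm) fun i => hy _) ?_
    rw [Formula.eval_ofNorms]
    have e : (w ∘ Fintype.equivFin ι) ∘ (Fintype.equivFin ι).symm = w := by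
      funext i
      simp
    rw [assign, e] at hle
    exact hle
  have h1 := (Formula.le_eval_sups ((Formula.ofNorms u hu t).infs _) (v := Fin.elim0)
    (w := x ∘ (Fintype.equivFin ι).symm) (fun i => i.elim0) (fun i => hx _)).trans key
  obtain ⟨w, hw, hlt⟩ := Formula.exists_lt_of_eval_infs_lt _ (h1.trans_lt hε)
  refine ⟨w ∘ Fintype.equivFin κ, fun k => hw _, ?_⟩
  rw [Formula.eval_ofNorms] at hlt
  have e : (w ∘ Fintype.equivFin κ) ∘ (Fintype.equivFin κ).symm = w := by
    funext i
    simp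
  rw [assign, e]
  exact hlt

/-- Transfer of `∃∀` statements from matrix algebras. -/
theorem IsPseudomatricial.exists_forall (hA : IsPseudomatricial A) {J : Type*} [Fintype J]
    (t : J → Poly₂ ι κ) (u : (J → ℝ) → ℝ) (hu : Continuous u)
    (h : ∀ N : ℕ, 0 < N → ∃ x : ι → Matrix (Fin N) (Fin N) ℂ, (∀ i, ‖x i‖ ≤ 1) ∧
      ∀ y : κ → Matrix (Fin N) (Fin N) ℂ, (∀ k, ‖y k‖ ≤ 1) →
        u (fun j => ‖(t j).eval (assign x y)‖) ≤ 0)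
    {ε : ℝ} (hε : 0 < ε) :
    ∃ x : ι → A, (∀ i, ‖x i‖ ≤ 1) ∧ ∀ y : κ → A, (∀ k, ‖y k‖ ≤ 1) →
      u (fun j => ‖(t j).eval (assign x y)‖) < ε := by
  have key := hA.value_le (((Formula.ofNorms u hu t).sups _).infs _) fun N hN => by
    obtain ⟨x, hx, hle⟩ := h N hN
    refine le_trans (Formula.eval_infs_le _ (fun i => i.elim0)
      (w := x ∘ (Fintype.equivFin ι).symm) fun i => hx _) ?_
    refine Formula.eval_sups_le _ fun w hw => ?_
    have := hle (w ∘ Fintype.equivFin κ) (fun i => hw _)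
    have e : (w ∘ Fintype.equivFin κ) ∘ (Fintype.equivFin κ).symm = w := by
      funext i
      simp
    rw [assign, e] at this
    rwa [Formula.eval_ofNorms]
  obtain ⟨w, hw, hlt⟩ := Formula.exists_lt_of_eval_infs_lt _ (key.trans_lt hε)
  refine ⟨w ∘ Fintype.equivFin ι, fun k => hw _, fun y hy => ?_⟩
  have h1 := (Formula.le_eval_sups (Formula.ofNorms u hu t)
    (w := y ∘ (Fintype.equivFin κ).symm) (norm_join_le (fun i => i.elim0) hw)
    (fun i => hy _)).trans_lt hlt
  rw [Formula.eval_ofNorms] at h1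
  have e : (w ∘ Fintype.equivFin ι) ∘ (Fintype.equivFin ι).symm = w := by
    funext i
    simp
  rw [assign, e]
  exact h1

end Transfer

/-! ### Functional calculus near projections and partial isometries. -/

section Stability

variable {A : Type*} [NonUnitalCStarAlgebra A]

/-- The function equal to `g` on `[1/2, ∞)` and to `0` on `(-∞, 1/2)`. -/
noncomputable def cutoff (g : ℝ → ℝ) (t : ℝ) : ℝ := if 1 / 2 ≤ t then g t else 0

theorem cutoff_zero (g : ℝ → ℝ) : cutoff g 0 = 0 := by
  norm_num [cutoff]

/-- The only possible jump is at $1/2$, which lies in a spectral gap in the application. -/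
theorem continuousOn_cutoff {g : ℝ → ℝ} (hg : ∀ t, 1 / 2 < t → ContinuousAt g t) {S : Set ℝ}
    (hS : (1 / 2 : ℝ) ∉ S) : ContinuousOn (cutoff g) S := by
  intro t ht
  refine ContinuousAt.continuousWithinAt ?_
  rcases lt_trichotomy t (1 / 2) with h | h | h
  · refine (continuousAt_const (y := (0 : ℝ))).congr ?_
    filter_upwards [Iio_mem_nhds h] with s hs
    simp only [cutoff, if_neg (not_le.mpr (Set.mem_Iio.mp hs))]
  · exact absurd (h ▸ ht) hS
  · refine (hg t h).congr ?_
    filter_upwards [Ioi_mem_nhds h] with s hs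
    simp only [cutoff, if_pos (Set.mem_Ioi.mp hs).le]

theorem abs_le_of_mem_quasispectrum {b : A} (hb : IsSelfAdjoint b) {δ : ℝ}
    (h : ‖b * b - b‖ ≤ δ) {t : ℝ} (ht : t ∈ quasispectrum ℝ b) : |t * t - t| ≤ δ := by
  have e : cfcₙ (fun t : ℝ => t * t - t) b = b * b - b := by
    rw [cfcₙ_sub (fun t : ℝ => t * t) (fun t : ℝ => t) b,
      cfcₙ_mul (fun t : ℝ => t) (fun t : ℝ => t) b, cfcₙ_id' ℝ b]
  rw [← e, norm_cfcₙ_le_iff (fun t : ℝ => t * t - t) b δ] at h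
  exact h t ht

theorem norm_le_of_sq_le {x : A} {r : ℝ} (hr : 0 ≤ r)
    (h : ‖star x * x‖ ≤ r * r) : ‖x‖ ≤ r := by
  rw [CStarRing.norm_star_mul_self] at h
  nlinarith [norm_nonneg x]

theorem abs_le_of_abs_mul_self_sub_le {t δ : ℝ} (ht : |t * t - t| ≤ δ) :
    (1 / 2 ≤ t → |1 - t| ≤ 2 * δ) ∧ (t < 1 / 2 → |t| ≤ 2 * δ) := by
  have h1 : |t| * |1 - t| ≤ δ := by
    rwa [← abs_mul, mul_sub, mul_one, abs_sub_comm]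
  constructor
  · intro h2
    have : 1 / 2 ≤ |t| := h2.trans (le_abs_self t)
    nlinarith [abs_nonneg (1 - t)]
  · intro h2
    have : 1 / 2 ≤ |1 - t| := le_trans (by linarith) (le_abs_self (1 - t))
    nlinarith [abs_nonneg t]

/-- The expression is $(1-\sqrt t)^2\le|1-\sqrt t|(1+\sqrt t)=|1-t|$. It is the function of $b=x^*x$
that represents $(u-x)^*(u-x)$ above the gap, for $u=x\,b^{-1/2}$. -/
theorem abs_one_sub_sqrt_le {t ε : ℝ} (h : 1 / 2 ≤ t) (ht : |1 - t| ≤ ε) :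
    |1 - t * (√t)⁻¹ - t * (√t)⁻¹ + t| ≤ ε := by
  have h0 : √t * √t = t := Real.mul_self_sqrt (by linarith)
  have h1 : 0 < √t := Real.sqrt_pos.mpr (by linarith)
  have h4 : t * (√t)⁻¹ = √t := by
    rw [← div_eq_mul_inv, div_eq_iff h1.ne', h0]
  have h5 : 1 - √t - √t + t = (1 - √t) ^ 2 := by linear_combination -h0
  rw [h4, h5, abs_of_nonneg (sq_nonneg _)]
  refine le_trans ?_ ht
  have h6 : 1 - t = (1 - √t) * (1 + √t) := by linear_combination h0
  rw [h6, abs_mul, abs_of_pos (by linarith : 0 < 1 + √t), ← sq_abs, pow_two]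
  refine mul_le_mul_of_nonneg_left ?_ (abs_nonneg _)
  rw [abs_le]
  constructor <;> linarith

/-- An element `x` for which `x⋆ x` is almost a projection is close to a partial isometry. -/
theorem exists_partialIsometry_near (x : A) {δ : ℝ} (hδ : δ < 1 / 4)
    (h : ‖star x * x * (star x * x) - star x * x‖ ≤ δ) :
    ∃ u k g : A, IsStarProjection (star u * u) ∧ star u * u = k * (star x * x) ∧ u = x * g ∧
      ‖star u * u - star x * x‖ ≤ 2 * δ ∧ ‖u - x‖ ^ 2 ≤ 2 * δ := by
  set b := star x * x with hb
  have hsa : IsSelfAdjoint b := IsSelfAdjoint.star_mul_self x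
  have hq : ∀ t ∈ quasispectrum ℝ b, |t * t - t| ≤ δ := fun t =>
    abs_le_of_mem_quasispectrum hsa h
  -- Here $|t^2-t|=1/4>\delta$ at $t=1/2$.
  have hhalf : (1 / 2 : ℝ) ∉ quasispectrum ℝ b := fun hm => by
    have := hq _ hm
    norm_num [abs_of_neg] at this
    linarith
  have hF : ContinuousOn (cutoff fun _ => 1) (quasispectrum ℝ b) :=
    continuousOn_cutoff (fun t _ => continuousAt_const) hhalf
  have hK : ContinuousOn (cutoff fun t => t⁻¹) (quasispectrum ℝ b) :=
    continuousOn_cutoff (fun t ht => continuousAt_inv₀ (by positivity)) hhalf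
  have hG : ContinuousOn (cutoff fun t => (√t)⁻¹) (quasispectrum ℝ b) :=
    continuousOn_cutoff (fun t ht => (Real.continuous_sqrt.continuousAt).inv₀
      (Real.sqrt_pos.mpr (by linarith)).ne') hhalf
  have hF0 := cutoff_zero fun _ => 1
  have hK0 := cutoff_zero fun t => t⁻¹
  have hG0 := cutoff_zero fun t => (√t)⁻¹
  set F := cfcₙ (cutoff fun _ => 1) b with hFd
  set G := cfcₙ (cutoff fun t => (√t)⁻¹) b with hGd
  have hGs : IsSelfAdjoint G := cfcₙ_predicate _ _
  have hFs : IsSelfAdjoint F := cfcₙ_predicate _ _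
  have hbG : cfcₙ (fun t => t * cutoff (fun t => (√t)⁻¹) t) b = b * G := by
    rw [cfcₙ_mul (fun t : ℝ => t) _ b, cfcₙ_id' ℝ b]
  have hGb : cfcₙ (fun t => t * cutoff (fun t => (√t)⁻¹) t) b = G * b := by
    have e : (fun t => t * cutoff (fun t => (√t)⁻¹) t) =
        fun t => cutoff (fun t => (√t)⁻¹) t * t := funext fun t => mul_comm _ _
    rw [e, cfcₙ_mul _ (fun t : ℝ => t) b hG hG0, cfcₙ_id' ℝ b]
  have hGbG : G * b * G = F := by
    rw [← hGb, hGd, ← cfcₙ_mul (fun t => t * cutoff (fun t => (√t)⁻¹) t) _ b]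
    congr 1
    funext t
    unfold cutoff
    split_ifs with ht
    · have h0 : √t * √t = t := Real.mul_self_sqrt (by linarith)
      have h1 : √t ≠ 0 := (Real.sqrt_pos.mpr (by linarith)).ne'
      field_simp
      nlinarith
    · simp
  have hFF : F * F = F := by
    rw [hFd, ← cfcₙ_mul _ _ b]
    congr 1
    funext t
    unfold cutoff
    split_ifs <;> simp
  have huu : star (x * G) * (x * G) = F := by
    rw [star_mul, hGs.star_eq, ← hGbG, hb]
    simp only [mul_assoc]
  have key := fun (t : ℝ) (ht : |t * t - t| ≤ δ) => abs_le_of_abs_mul_self_sub_le ht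
  -- The polar part of $x$, with the spectrum below the gap discarded. The factorisations
  -- $u^*u=k\,x^*x$ and $u=xg$ are recorded because they preserve right and left support conditions
  -- on $x$.
  refine ⟨x * G, cfcₙ (cutoff fun t => t⁻¹) b, G, ?_, ?_, rfl, ?_, ?_⟩
  · rw [huu]
    exact ⟨hFF, hFs⟩
  · rw [huu]
    have e : cfcₙ (fun t => cutoff (fun t => t⁻¹) t * t) b = cfcₙ (cutoff fun t => t⁻¹) b * b := by
      rw [cfcₙ_mul _ (fun t : ℝ => t) b hK hK0, cfcₙ_id' ℝ b]
    rw [← e, hFd]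
    congr 1
    funext t
    unfold cutoff
    split_ifs with ht
    · rw [inv_mul_cancel₀ (by linarith)]
    · simp
  · rw [huu]
    have e : cfcₙ (fun t => cutoff (fun _ => 1) t - t) b = F - b := by
      rw [cfcₙ_sub _ (fun t : ℝ => t) b, cfcₙ_id' ℝ b]
    rw [← e]
    refine norm_cfcₙ_le fun t ht => ?_
    rw [Real.norm_eq_abs]
    unfold cutoff
    split_ifs with h2
    · exact (key t (hq t ht)).1 h2
    · rw [zero_sub, abs_neg]
      exact (key t (hq t ht)).2 (not_le.mp h2)
  · rw [pow_two, ← CStarRing.norm_star_mul_self]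
    have e : star (x * G - x) * (x * G - x) = cfcₙ (fun t => cutoff (fun _ => 1) t -
        t * cutoff (fun t => (√t)⁻¹) t - t * cutoff (fun t => (√t)⁻¹) t + t) b := by
      have c : ContinuousOn (fun t : ℝ => t * cutoff (fun t => (√t)⁻¹) t) (quasispectrum ℝ b) :=
        continuousOn_id.mul hG
      rw [cfcₙ_add (fun t => cutoff (fun _ => 1) t - t * cutoff (fun t => (√t)⁻¹) t -
          t * cutoff (fun t => (√t)⁻¹) t) (fun t : ℝ => t) b ((hF.sub c).sub c) (by simp [hF0])
          continuousOn_id rfl, cfcₙ_id' ℝ b,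
        cfcₙ_sub (fun t => cutoff (fun _ => 1) t - t * cutoff (fun t => (√t)⁻¹) t)
          (fun t => t * cutoff (fun t => (√t)⁻¹) t) b (hF.sub c) (by simp [hF0]) c (by simp),
        cfcₙ_sub (cutoff fun _ => 1) (fun t => t * cutoff (fun t => (√t)⁻¹) t) b hF hF0 c (by simp),
        ← hFd]
      nth_rewrite 1 [hGb]
      rw [hbG, ← huu, star_sub, star_mul, hGs.star_eq, hb]
      simp only [mul_sub, sub_mul, mul_assoc]
      abel
    rw [e]
    refine norm_cfcₙ_le fun t ht => ?_
    rw [Real.norm_eq_abs]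
    unfold cutoff
    split_ifs with h2
    · exact abs_one_sub_sqrt_le h2 ((key t (hq t ht)).1 h2)
    · simpa using (key t (hq t ht)).2 (not_le.mp h2)

end Stability

/-! ### Perturbation of projections, equivalences and orthogonal families. -/

section ProjectionCalculus

variable {A : Type*} [NonUnitalCStarAlgebra A]

theorem norm_mul_sub_mul_le {a b c d : A} (hb : ‖b‖ ≤ 1) (hc : ‖c‖ ≤ 1) :
    ‖a * b - c * d‖ ≤ ‖a - c‖ + ‖b - d‖ := by
  have e : a * b - c * d = (a - c) * b + c * (b - d) := by
    simp only [sub_mul, mul_sub]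
    abel
  rw [e]
  refine (norm_add_le _ _).trans (add_le_add ?_ ?_)
  · exact (norm_mul_le _ _).trans (mul_le_of_le_one_right (norm_nonneg _) hb)
  · exact (norm_mul_le _ _).trans (mul_le_of_le_one_left (norm_nonneg _) hc)

theorem norm_star_mul_self_sub_le {x y : A} (hx : ‖x‖ ≤ 1) (hy : ‖y‖ ≤ 1) :
    ‖star x * x - star y * y‖ ≤ 2 * ‖x - y‖ := by
  refine (norm_mul_sub_mul_le hx (by rwa [norm_star])).trans ?_
  rw [← star_sub, norm_star, two_mul]

theorem norm_mul_star_self_sub_le {x y : A} (hx : ‖x‖ ≤ 1) (hy : ‖y‖ ≤ 1) :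
    ‖x * star x - y * star y‖ ≤ 2 * ‖x - y‖ := by
  refine (norm_mul_sub_mul_le (by rwa [norm_star]) hy).trans ?_
  rw [← star_sub, norm_star, two_mul]

theorem norm_mul_self_sub_self_le {b c : A} (hb : ‖b‖ ≤ 1) (hc : ‖c‖ ≤ 1) :
    ‖b * b - b‖ ≤ ‖c * c - c‖ + 3 * ‖b - c‖ := by
  have e : b * b - b = (c * c - c) + (b * b - c * c) - (b - c) := by abel
  rw [e]
  have := norm_sub_le (c * c - c + (b * b - c * c)) (b - c)
  have := norm_add_le (c * c - c) (b * b - c * c)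
  have := norm_mul_sub_mul_le (d := c) (a := b) hb hc
  linarith

theorem norm_le_one_of_star_mul_self {u : A} (h : IsStarProjection (star u * u)) : ‖u‖ ≤ 1 :=
  norm_le_of_sq_le zero_le_one (by simpa using h.norm_le)

theorem IsStarProjection.eq_zero_of_norm_lt {p : A} (hp : IsStarProjection p) (h : ‖p‖ < 1) :
    p = 0 := by
  have h1 : ‖p‖ = ‖p‖ * ‖p‖ := by
    rw [← CStarRing.norm_star_mul_self, hp.isSelfAdjoint.star_eq, hp.isIdempotentElem.eq]
  rw [← norm_eq_zero]
  have := norm_nonneg p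
  nlinarith

theorem IsStarProjection.norm_eq_one {p : A} (hp : IsStarProjection p) (h : p ≠ 0) : ‖p‖ = 1 :=
  le_antisymm hp.norm_le (not_lt.mp fun hlt => h (IsStarProjection.eq_zero_of_norm_lt hp hlt))

theorem IsStarProjection.mul_comm_of_mul_eq {p q : A} (hp : IsStarProjection p)
    (hq : IsStarProjection q) (h : p * q = q) : q * p = q := by
  have := congrArg star h
  rwa [star_mul, hp.isSelfAdjoint.star_eq, hq.isSelfAdjoint.star_eq] at this

theorem IsStarProjection.mul_eq_zero_comm {p q : A} (hp : IsStarProjection p)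
    (hq : IsStarProjection q) (h : p * q = 0) : q * p = 0 := by
  have := congrArg star h
  rwa [star_mul, hp.isSelfAdjoint.star_eq, hq.isSelfAdjoint.star_eq, star_zero] at this

/-- The difference is itself a projection, and a projection of norm less than $1$ is zero. This is
how norm estimates become exact equalities. -/
theorem IsStarProjection.eq_of_norm_sub_lt {p q : A} (hp : IsStarProjection p)
    (hq : IsStarProjection q) (h : p * q = q) (hlt : ‖p - q‖ < 1) : q = p :=
  (sub_eq_zero.mp (IsStarProjection.eq_zero_of_norm_lt (hq.sub_of_mul_eq_right hp h) hlt)).symm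

theorem mul_star_mul_self {u : A} (h : IsStarProjection (star u * u)) : u * (star u * u) = u := by
  rw [← sub_eq_zero, ← CStarRing.star_mul_self_eq_zero_iff]
  have := h.isIdempotentElem.eq
  simp only [star_sub, star_mul, star_star, mul_sub, sub_mul]
  simp only [mul_assoc] at this ⊢
  simp only [this, sub_self]

theorem isStarProjection_mul_star {u : A} (h : IsStarProjection (star u * u)) :
    IsStarProjection (u * star u) := by
  refine ⟨?_, IsSelfAdjoint.mul_star_self u⟩
  have := mul_star_mul_self h
  rw [IsIdempotentElem, mul_assoc u, ← mul_assoc (star u), ← mul_assoc u, this]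

theorem star_mul_star_mul_self {u : A} (h : IsStarProjection (star u * u)) :
    star u * (u * star u) = star u := by
  have := congrArg star (mul_star_mul_self h)
  simpa [mul_assoc] using this

theorem MvNEquiv.symm {p q : A} (h : MvNEquiv p q) : MvNEquiv q p := by
  obtain ⟨v, h1, h2⟩ := h
  exact ⟨star v, by rwa [star_star], by rwa [star_star]⟩

theorem MvNEquiv.trans {p q r : A} (hq : IsStarProjection q) (h : MvNEquiv p q)
    (h' : MvNEquiv q r) : MvNEquiv p r := by
  obtain ⟨v, rfl, rfl⟩ := h
  obtain ⟨w, h3, rfl⟩ := h'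
  have hv : IsStarProjection (star v * v) := by
    simpa using isStarProjection_mul_star (u := star v) (by simpa using hq)
  have hw : IsStarProjection (star w * w) := h3 ▸ hq
  refine ⟨w * v, ?_, ?_⟩
  · rw [star_mul, mul_assoc, ← mul_assoc (star w), h3, mul_assoc v, mul_star_mul_self hv]
  · rw [star_mul, mul_assoc, ← mul_assoc v, ← h3, mul_assoc (star w),
      star_mul_star_mul_self hw]

theorem MvNEquiv.isStarProjection {p q : A} (hp : IsStarProjection p) (h : MvNEquiv p q) :
    IsStarProjection q := by
  obtain ⟨v, rfl, rfl⟩ := h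
  exact isStarProjection_mul_star hp

theorem MvNEquiv.eq_zero {p : A} (h : MvNEquiv p 0) : p = 0 := by
  obtain ⟨v, rfl, h2⟩ := h
  rw [CStarRing.mul_star_self_eq_zero_iff] at h2
  simp [h2]

/-- The subprojection witnessing a subequivalence. -/
theorem MvNLE.exists_equiv {p q : A} (hp : IsStarProjection p) (h : MvNLE p q) :
    ∃ r, IsStarProjection r ∧ MvNEquiv p r ∧ q * r = r := by
  obtain ⟨v, rfl, h2⟩ := h
  exact ⟨_, isStarProjection_mul_star hp, ⟨v, rfl, rfl⟩, h2⟩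

theorem MvNEquiv.mvnLE {p q r : A} (h : MvNEquiv p r) (hr : q * r = r) : MvNLE p q := by
  obtain ⟨v, h1, rfl⟩ := h
  exact ⟨v, h1, hr⟩

/-- The single relation $x^*x\approx x$ carries both self-adjointness and idempotence, so it is the
form in which "is a projection" enters the transferred formulas. -/
theorem exists_projection_near {x : A} (hx : ‖x‖ ≤ 1) {δ : ℝ} (hδ : δ ≤ 1 / 16)
    (h : ‖star x * x - x‖ ≤ δ) : ∃ p : A, IsStarProjection p ∧ ‖p - x‖ ≤ 5 * δ := by
  have h2 : ‖star x * x * (star x * x) - star x * x‖ ≤ 2 * δ := by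
    have hn : ‖star x * x‖ ≤ 1 := by
      rw [CStarRing.norm_star_mul_self]
      nlinarith [norm_nonneg x]
    refine (norm_mul_sub_mul_le hn (by rwa [norm_star])).trans ?_
    have : star x * x - star x = star (star x * x - x) := by simp
    rw [this, norm_star]
    linarith
  obtain ⟨u, k, g, hu, -, -, h3, -⟩ := exists_partialIsometry_near x (by linarith) h2
  refine ⟨_, hu, ?_⟩
  have := norm_sub_le_norm_sub_add_norm_sub (star u * u) (star x * x) x
  linarith

/-- An almost partial isometry with source almost `p` can be corrected to have source `p`. -/
theorem exists_partialIsometry_of_near {p w : A} (hp : IsStarProjection p) (hw : w * p = w)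
    {η : ℝ} (hη : η ≤ 1 / 20) (h : ‖star w * w - p‖ ≤ η) :
    ∃ u : A, star u * u = p ∧ (∀ q : A, q * w = w → q * u = u) ∧ ‖u - w‖ ^ 2 ≤ 4 * η := by
  have hη0 : 0 ≤ η := (norm_nonneg _).trans h
  have h1 : ‖star w * w‖ ≤ 1 + η := by
    have := norm_le_norm_add_norm_sub p (star w * w)
    have h2 := hp.norm_le
    rw [norm_sub_rev] at this
    linarith
  have h2 : ‖star w * w * (star w * w) - star w * w‖ ≤ 2 * η := by
    have e : star w * w * (star w * w) - star w * w = star w * w * (star w * w - p) := by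
      rw [mul_sub, mul_assoc (star w) w p, hw]
    rw [e]
    refine (norm_mul_le _ _).trans ((mul_le_mul h1 h (norm_nonneg _) (by linarith)).trans ?_)
    nlinarith
  obtain ⟨u, k, g, hu, hk, hg, h3, h4⟩ := exists_partialIsometry_near w (by linarith) h2
  have h5 : star u * u = p := by
    refine IsStarProjection.eq_of_norm_sub_lt hp hu ?_ ?_
    · have h6 : star u * u * p = star u * u := by
        rw [hk, mul_assoc, mul_assoc (star w), hw]
      have := congrArg star h6
      rwa [star_mul, hp.isSelfAdjoint.star_eq, hu.isSelfAdjoint.star_eq] at this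
    · have := norm_sub_le_norm_sub_add_norm_sub p (star w * w) (star u * u)
      rw [norm_sub_rev p (star w * w), norm_sub_rev (star w * w) (star u * u)] at this
      linarith
  exact ⟨u, h5, fun q hq => by rw [hg, ← mul_assoc, hq], by linarith⟩

/-- The polar part of $qp$ has source $p$, and its range is a subprojection of $q$ at distance less
than $1$ from $q$. -/
theorem mvnEquiv_of_norm_sub_le {p q : A} (hp : IsStarProjection p) (hq : IsStarProjection q)
    (h : ‖p - q‖ ≤ 1 / 400) : MvNEquiv p q := by
  have e : star (q * p) * (q * p) = p * q * p := by
    rw [star_mul, hp.isSelfAdjoint.star_eq, hq.isSelfAdjoint.star_eq, mul_assoc, ← mul_assoc q,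
      hq.isIdempotentElem.eq, mul_assoc]
  have e' : (q * p) * star (q * p) = q * p * q := by
    rw [star_mul, hp.isSelfAdjoint.star_eq, hq.isSelfAdjoint.star_eq, mul_assoc, ← mul_assoc p,
      hp.isIdempotentElem.eq, mul_assoc]
  have hc : ∀ {p q : A}, IsStarProjection p → ‖p - q‖ ≤ 1 / 400 → ‖p * q * p - p‖ ≤ 1 / 400 := by
    intro p q hp h
    have : p * q * p - p = p * (q - p) * p := by
      rw [mul_sub, sub_mul, hp.isIdempotentElem.eq, hp.isIdempotentElem.eq]
    rw [this]
    rw [norm_sub_rev] at h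
    refine (norm_mul_le _ _).trans ((mul_le_of_le_one_right (norm_nonneg _) hp.norm_le).trans ?_)
    exact (norm_mul_le _ _).trans ((mul_le_of_le_one_left (norm_nonneg _) hp.norm_le).trans h)
  obtain ⟨u, h1, h2, h3⟩ := exists_partialIsometry_of_near (w := q * p) (η := 1 / 400) hp
    (by rw [mul_assoc, hp.isIdempotentElem.eq]) (by norm_num) (by rw [e]; exact hc hp h)
  have h4 : ‖u - q * p‖ ≤ 1 / 10 := by
    nlinarith [norm_nonneg (u - q * p)]
  have hqu := h2 q (by rw [← mul_assoc, hq.isIdempotentElem.eq])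
  refine ⟨u, h1, ?_⟩
  have hu : IsStarProjection (star u * u) := h1 ▸ hp
  refine IsStarProjection.eq_of_norm_sub_lt hq (isStarProjection_mul_star hu)
    (by rw [← mul_assoc, hqu]) ?_
  have h5 : ‖q * p‖ ≤ 1 := (norm_mul_le _ _).trans
    (mul_le_one₀ hq.norm_le (norm_nonneg _) hp.norm_le)
  have h6 := norm_mul_star_self_sub_le (norm_le_one_of_star_mul_self hu) h5
  rw [e'] at h6
  have h7 := hc hq (by rwa [norm_sub_rev])
  have := norm_sub_le_norm_sub_add_norm_sub q (q * p * q) (u * star u)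
  rw [norm_sub_rev q (q * p * q), norm_sub_rev (q * p * q) (u * star u)] at this
  linarith

/-- Cutting $v$ down to $qvp$ makes the support conditions exact at the cost of $2c$. The correction
to a partial isometry with source $p$ keeps its range under $q$. -/
theorem mvnLE_of_near {p q v : A} (hp : IsStarProjection p) (hq : IsStarProjection q)
    (hv : ‖v‖ ≤ 1) {c : ℝ} (hc : c ≤ 1 / 100) (h1 : ‖q * v - v‖ ≤ c) (h2 : ‖v * p - v‖ ≤ c)
    (h3 : ‖star v * v - p‖ ≤ c) : MvNLE p q := by
  have hw : ‖q * v * p‖ ≤ 1 := (norm_mul_le _ _).trans (mul_le_one₀ ((norm_mul_le _ _).trans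
    (mul_le_one₀ hq.norm_le (norm_nonneg _) hv)) (norm_nonneg _) hp.norm_le)
  have hd : ‖q * v * p - v‖ ≤ 2 * c := by
    have e : q * v * p - v = (q * v - v) * p + (v * p - v) := by
      rw [sub_mul]
      abel
    rw [e]
    refine (norm_add_le _ _).trans ?_
    have := (norm_mul_le (q * v - v) p).trans
      (mul_le_of_le_one_right (norm_nonneg _) hp.norm_le)
    linarith
  have h4 := norm_star_mul_self_sub_le hw hv
  obtain ⟨u, h5, h6, -⟩ := exists_partialIsometry_of_near (w := q * v * p) (η := 1 / 20) hp
    (by rw [mul_assoc, hp.isIdempotentElem.eq]) le_rfl (by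
      have := norm_sub_le_norm_sub_add_norm_sub (star (q * v * p) * (q * v * p)) (star v * v) p
      linarith)
  exact ⟨u, h5, by rw [← mul_assoc, h6 q (by
    rw [← mul_assoc, ← mul_assoc, hq.isIdempotentElem.eq])]⟩

/-- Almost orthogonal almost partial isometries into `p` are close to orthogonal partial
isometries into `p`. -/
theorem exists_orthogonal_near {ι : Type*} (s : Finset ι) : ∀ ε > 0, ∃ δ > 0,
    ∀ (p : A), IsStarProjection p → ∀ x : ι → A, (∀ i ∈ s, ‖x i‖ ≤ 1) →
    (∀ i ∈ s, ‖star (x i) * x i * (star (x i) * x i) - star (x i) * x i‖ ≤ δ) →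
    (∀ i ∈ s, ‖p * x i - x i‖ ≤ δ) →
    (∀ i ∈ s, ∀ j ∈ s, i ≠ j → ‖star (x i) * x j‖ ≤ δ) →
    ∃ y : ι → A, (∀ i ∈ s, IsStarProjection (star (y i) * y i) ∧ p * y i = y i ∧
      ‖y i - x i‖ ≤ ε) ∧ ∀ i ∈ s, ∀ j ∈ s, i ≠ j → star (y i) * y j = 0 := by
  classical
  induction s using Finset.induction_on with
  | empty => exact fun ε _ => ⟨1, one_pos, fun p _ x _ _ _ _ => ⟨x, by simp, by simp⟩⟩
  | insert a s ha ih =>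
    intro ε hε
    obtain ⟨δ₀, hδ₀, H⟩ := ih ε hε
    -- The vectors $x_i$ with $i\ne a$ must be almost under $p-uu^*$. The error is at most
    -- $\delta+r+\delta$, so each of the three terms is kept below $\delta_0/3$.
    set r := min ε (δ₀ / 3) with hr
    have hr0 : 0 < r := lt_min hε (by positivity)
    have hr1 : r ≤ ε := min_le_left _ _
    have hr2 : r ≤ δ₀ / 3 := min_le_right _ _
    obtain ⟨δ, hδ, hd1, hd2, hd3, hd4⟩ : ∃ δ > 0, δ ≤ 1 / 100 ∧ δ ≤ r ^ 2 / 64 ∧ δ ≤ r / 2 ∧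
        δ ≤ δ₀ / 3 :=
      ⟨min (min (1 / 100) (r ^ 2 / 64)) (min (r / 2) (δ₀ / 3)),
        lt_min (lt_min (by norm_num) (by positivity)) (lt_min (by positivity) (by positivity)),
        (min_le_left _ _).trans (min_le_left _ _), (min_le_left _ _).trans (min_le_right _ _),
        (min_le_right _ _).trans (min_le_left _ _), (min_le_right _ _).trans (min_le_right _ _)⟩
    refine ⟨δ, hδ, fun p hp x hx hb hpx ho => ?_⟩
    have has := Finset.mem_insert_self a s
    have hsub : ∀ i ∈ s, i ∈ insert a s := fun i hi => Finset.mem_insert_of_mem hi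
    have hxa := hx a has
    have hx' : ‖p * x a‖ ≤ 1 := (norm_mul_le _ _).trans
      (mul_le_one₀ hp.norm_le (norm_nonneg _) hxa)
    have hsq : ∀ {z : A}, ‖z‖ ≤ 1 → ‖star z * z‖ ≤ 1 := fun {z} hz => by
      rw [CStarRing.norm_star_mul_self]
      exact mul_le_one₀ hz (norm_nonneg _) hz
    have h1 := norm_mul_self_sub_self_le (hsq hx') (hsq hxa)
    have h2 := norm_star_mul_self_sub_le hx' hxa
    have h3 := hpx a has
    have h4 := hb a has
    -- Passing from $x_a$ to $px_a$ moves $x_a^*x_a$ by at most $2\delta$, hence the defect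
    -- $\delta+3\cdot2\delta$.
    obtain ⟨u, k, g, hu, -, hg, -, h5⟩ := exists_partialIsometry_near (p * x a) (δ := 7 * δ)
      (by linarith) (by linarith)
    have hpu : p * u = u := by rw [hg, ← mul_assoc, ← mul_assoc, hp.isIdempotentElem.eq]
    have h6 : ‖u - p * x a‖ ≤ r / 2 := by
      refine abs_le_of_sq_le_sq' ?_ (by positivity) |>.2
      nlinarith
    have h7 : ‖u - x a‖ ≤ r := by
      have := norm_sub_le_norm_sub_add_norm_sub u (p * x a) (x a)
      linarith
    have hpr := isStarProjection_mul_star hu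
    have hp' : IsStarProjection (p - u * star u) :=
      hpr.sub_of_mul_eq_right hp (by rw [← mul_assoc, hpu])
    have hun := norm_le_one_of_star_mul_self hu
    -- Correcting the remaining family below the complement of $uu^*$ makes it exactly orthogonal to
    -- $u$.
    obtain ⟨y, hy, hyo⟩ := H (p - u * star u) hp' x (fun i hi => hx i (hsub i hi))
      (fun i hi => (hb i (hsub i hi)).trans (by linarith)) (fun i hi => by
        have e : (p - u * star u) * x i - x i =
            (p * x i - x i) - u * (star u * x i) := by
          rw [sub_mul, mul_assoc]
          abel
        have e2 : star u * x i = star (u - x a) * x i + star (x a) * x i := by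
          rw [star_sub, sub_mul]
          abel
        rw [e]
        refine (norm_sub_le _ _).trans ?_
        have i1 := hpx i (hsub i hi)
        have i2 := (norm_mul_le u (star u * x i)).trans
          (mul_le_of_le_one_left (norm_nonneg _) hun)
        have i3 : ‖star u * x i‖ ≤ ‖u - x a‖ + ‖star (x a) * x i‖ := by
          rw [e2]
          refine (norm_add_le _ _).trans (add_le_add_left ?_ _)
          refine (norm_mul_le _ _).trans ?_
          rw [norm_star]
          exact mul_le_of_le_one_right (norm_nonneg _) (hx i (hsub i hi))
        have i4 := ho a has i (hsub i hi) (fun h => ha (h ▸ hi))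
        linarith)
      (fun i hi j hj hij => (ho i (hsub i hi) j (hsub j hj) hij).trans (by linarith))
    have huy : ∀ i ∈ s, star u * y i = 0 := fun i hi => by
      rw [← (hy i hi).2.1, ← mul_assoc, mul_sub, star_mul_star_mul_self hu]
      have := congrArg star hpu
      rw [star_mul, hp.isSelfAdjoint.star_eq] at this
      rw [this, sub_self, zero_mul]
    have hne : ∀ i ∈ s, i ≠ a := fun i hi h => ha (h ▸ hi)
    refine ⟨Function.update y a u, fun i hi => ?_, fun i hi j hj hij => ?_⟩
    · rcases Finset.mem_insert.mp hi with rfl | hi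
      · simpa using ⟨hu, hpu, h7.trans hr1⟩
      · rw [Function.update_of_ne (hne i hi)]
        obtain ⟨j1, j2, j3⟩ := hy i hi
        refine ⟨j1, ?_, j3⟩
        rw [← j2, ← mul_assoc, mul_sub, hp.isIdempotentElem.eq, ← mul_assoc, hpu]
    · rcases Finset.mem_insert.mp hi with rfl | hi'
      · rcases Finset.mem_insert.mp hj with rfl | hj'
        · exact absurd rfl hij
        · rw [Function.update_self, Function.update_of_ne (hne j hj')]
          exact huy j hj'
      · rcases Finset.mem_insert.mp hj with rfl | hj'
        · rw [Function.update_self, Function.update_of_ne (hne i hi')]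
          have := congrArg star (huy i hi')
          simpa using this
        · rw [Function.update_of_ne (hne i hi'), Function.update_of_ne (hne j hj')]
          exact hyo i hi' j hj' hij

end ProjectionCalculus

/-! ### Projections that are finite sums of copies of one projection. -/

section MatrixUnits

/-- A finite family of partial isometries with orthogonal ranges and common source `f`. -/
def IsColumn {B ι : Type*} [NonUnitalNonAssocSemiring B] [Star B] (f : B) (w : ι → B) :
    Prop :=
  ∀ i j, (i = j → star (w i) * w j = f) ∧ (i ≠ j → star (w i) * w j = 0)

variable {B : Type*} [NonUnitalCStarAlgebra B] {f : B} {ι κ : Type*} {w : ι → B}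

theorem IsColumn.star_mul_self (hw : IsColumn f w) (i : ι) : star (w i) * w i = f := (hw i i).1 rfl

theorem IsColumn.star_mul_of_ne (hw : IsColumn f w) {i j : ι} (h : i ≠ j) :
    star (w i) * w j = 0 := (hw i j).2 h

theorem IsColumn.mul_source (hf : IsStarProjection f) (hw : IsColumn f w) (i : ι) :
    w i * f = w i := by
  have h := hw.star_mul_self i
  rw [← h]
  exact mul_star_mul_self (h ▸ hf)

theorem mul_star_mul_mul_star (a b c d : B) :
    a * star b * (c * star d) = a * (star b * c) * star d := by
  simp only [mul_assoc]

variable [Fintype ι]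

theorem IsColumn.sum_mul_sum (hw : IsColumn f w) (a b : ι → B) :
    (∑ i, a i * star (w i)) * (∑ i, w i * star (b i)) = ∑ i, a i * f * star (b i) := by
  rw [Finset.sum_mul_sum]
  refine Finset.sum_congr rfl fun i _ => ?_
  rw [Finset.sum_eq_single i, mul_star_mul_mul_star, hw.star_mul_self i]
  · intro j _ hj
    rw [mul_star_mul_mul_star, hw.star_mul_of_ne hj.symm, mul_zero, zero_mul]
  · simp

theorem IsColumn.isStarProjection_sum (hf : IsStarProjection f) (hw : IsColumn f w) :
    IsStarProjection (∑ i, w i * star (w i)) := by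
  refine ⟨?_, ?_⟩
  · rw [IsIdempotentElem, hw.sum_mul_sum w w]
    simp only [hw.mul_source hf]
  · simp [IsSelfAdjoint, star_sum]

theorem IsColumn.sum_mul (hf : IsStarProjection f) (hw : IsColumn f w) (i : ι) :
    (∑ i, w i * star (w i)) * w i = w i := by
  rw [Finset.sum_mul, Finset.sum_eq_single i, mul_assoc, hw.star_mul_self i, hw.mul_source hf]
  · intro j _ hj
    rw [mul_assoc, hw.star_mul_of_ne hj, mul_zero]
  · simp

theorem IsColumn.mvnLE [Fintype κ] {z : κ → B} (hf : IsStarProjection f) (hw : IsColumn f w)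
    (hz : IsColumn f z) (σ : ι ↪ κ) :
    MvNLE (∑ i, w i * star (w i)) (∑ j, z j * star (z j)) := by
  have hz' : IsColumn f (z ∘ σ) := fun i j =>
    ⟨fun h => (hz _ _).1 (congrArg σ h), fun h => (hz _ _).2 (σ.injective.ne h)⟩
  refine ⟨∑ i, z (σ i) * star (w i), ?_, ?_⟩
  · rw [star_sum]
    simp only [star_mul, star_star]
    refine (hz'.sum_mul_sum w w).trans ?_
    simp only [hw.mul_source hf]
  · rw [← mul_assoc]
    congr 1
    rw [Finset.mul_sum]
    refine Finset.sum_congr rfl fun i _ => ?_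
    rw [← mul_assoc, hz.sum_mul hf]

/-- Division with remainder of a projection that is a finite sum of copies of `f`. -/
theorem IsColumn.exists_division (hf : IsStarProjection f) {n : ℕ} {w : Fin n → B}
    (hw : IsColumn f w) (g z : B) (hz : star z * z = f) (hgz : g * z = z)
    (hg : IsStarProjection g) (d : ℕ) (hd : 1 ≤ d) :
    ∃ x : Fin d ⊕ Fin (d - 1) → B, (∀ i, IsStarProjection (star (x i) * x i)) ∧
      (∀ i j, i ≠ j → star (x i) * x j = 0) ∧
      (∀ i, (∑ i, w i * star (w i)) * x i = x i) ∧
      (∀ i j, star (x (.inl i)) * x (.inl i) = star (x (.inl j)) * x (.inl j)) ∧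
      (∀ j, x (.inr j) * g = x (.inr j)) ∧
      ∑ i, x i * star (x i) = ∑ i, w i * star (w i) := by
  -- The $n$ copies are arranged in $d$ blocks of $S$ copies with $k<d$ left over.
  obtain ⟨S, k, hk, rfl⟩ : ∃ S k, k < d ∧ n = d * S + k :=
    ⟨n / d, n % d, Nat.mod_lt _ hd, (Nat.div_add_mod n d).symm⟩
  let i₀ : Fin d := ⟨0, hd⟩
  let a : Fin d → Fin S → B := fun i s => w (finSumFinEquiv (.inl (finProdFinEquiv (i, s))))
  let b : Fin k → B := fun j => w (finSumFinEquiv (.inr j))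
  have haa : ∀ i, IsColumn f (a i) := fun i s t =>
    ⟨fun h => (hw _ _).1 (by rw [h]), fun h => (hw _ _).2 (by simpa using h)⟩
  have haa' : ∀ i j, i ≠ j → ∀ s t, star (a i s) * a j t = 0 := fun i j h s t =>
    (hw _ _).2 (by simp [h])
  have hab : ∀ i s j, star (a i s) * b j = 0 := fun i s j =>
    (hw _ _).2 (finSumFinEquiv.injective.ne (by simp))
  have hba : ∀ i s j, star (b j) * a i s = 0 := fun i s j =>
    (hw _ _).2 (finSumFinEquiv.injective.ne (by simp))
  have hbb : IsColumn f b := fun s t =>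
    ⟨fun h => (hw _ _).1 (by rw [h]), fun h => (hw _ _).2 (by simpa using h)⟩
  have hsum : ∑ i, w i * star (w i) =
      (∑ i, ∑ s, a i s * star (a i s)) + ∑ j, b j * star (b j) := by
    rw [← finSumFinEquiv.sum_comp, Fintype.sum_sum_type, ← finProdFinEquiv.sum_comp,
      Fintype.sum_prod_type]
  -- `X i` carries block $0$ onto block $i$, so all these elements have the same source. `Y j`
  -- carries the range of $z$, which is under $g$, onto a leftover copy. Padding by zeros gives
  -- $d-1$ remainders whatever $n$ is, since a formula has a fixed number of variables.
  let X : Fin d → B := fun i => ∑ s, a i s * star (a i₀ s)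
  let Y : Fin (d - 1) → B := fun j => if h : (j : ℕ) < k then b ⟨j, h⟩ * star z else 0
  have hXX : ∀ i, star (X i) * X i = ∑ s, a i₀ s * star (a i₀ s) := fun i => by
    simp only [X, star_sum, star_mul, star_star]
    rw [(haa i).sum_mul_sum]
    simp only [(haa _).mul_source hf]
  have hXX' : ∀ i j, i ≠ j → star (X i) * X j = 0 := fun i j h => by
    simp only [X, star_sum, star_mul, star_star, Finset.sum_mul_sum, mul_star_mul_mul_star,
      haa' i j h, mul_zero, zero_mul, Finset.sum_const_zero]
  have hXs : ∀ i, X i * star (X i) = ∑ s, a i s * star (a i s) := fun i => by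
    simp only [X, star_sum, star_mul, star_star]
    rw [(haa i₀).sum_mul_sum]
    simp only [(haa _).mul_source hf]
  have hzf : z * f = z := by
    rw [← hz]
    exact mul_star_mul_self (hz ▸ hf)
  have hXY : ∀ i j, star (X i) * Y j = 0 := fun i j => by
    simp only [Y]
    split_ifs
    · simp only [X, star_sum, star_mul, star_star, Finset.sum_mul, mul_star_mul_mul_star, hab,
        mul_zero, zero_mul, Finset.sum_const_zero]
    · simp
  have hYY : ∀ i j, i ≠ j → star (Y i) * Y j = 0 := fun i j h => by
    simp only [Y]
    split_ifs
    · rw [star_mul, star_star, mul_star_mul_mul_star, hbb.star_mul_of_ne (by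
        simpa [Fin.ext_iff] using h), mul_zero, zero_mul]
    all_goals simp
  have hYs : ∑ j, Y j * star (Y j) = ∑ j, b j * star (b j) := by
    have e : ∀ j, Y j * star (Y j) =
        if h : (j : ℕ) < k then b ⟨j, h⟩ * star (b ⟨j, h⟩) else 0 := fun j => by
      simp only [Y]
      split_ifs
      · rw [star_mul, star_star, mul_star_mul_mul_star, hz, hbb.mul_source hf]
      · simp
    simp only [e]
    obtain ⟨l, hl⟩ : ∃ l, d - 1 = k + l := ⟨d - 1 - k, by omega⟩
    rw [← (finCongr hl.symm).sum_comp, Fin.sum_univ_add]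
    simp
  have htot : ∑ i, (Sum.elim X Y) i * star ((Sum.elim X Y) i) = ∑ i, w i * star (w i) := by
    rw [Fintype.sum_sum_type, hsum]
    simp [hXs, hYs]
  have hproj : ∀ i, IsStarProjection (star (Sum.elim X Y i) * Sum.elim X Y i) := by
    rintro (i | j)
    · simp only [Sum.elim_inl, hXX]
      exact (haa i₀).isStarProjection_sum hf
    · simp only [Sum.elim_inr, Y]
      split_ifs
      · rw [star_mul, star_star, mul_star_mul_mul_star, hbb.star_mul_self, hzf]
        exact isStarProjection_mul_star (hz ▸ hf)
      · simp
  have horth : ∀ i j, i ≠ j → star (Sum.elim X Y i) * Sum.elim X Y j = 0 := by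
    rintro (i | i) (j | j) h
    · exact hXX' i j (by simpa using h)
    · exact hXY i j
    · have := congrArg star (hXY j i)
      simpa using this
    · exact hYY i j (by simpa using h)
  refine ⟨Sum.elim X Y, hproj, horth, fun i => ?_, fun i j => by simp [hXX], fun j => ?_, htot⟩
  · rw [← htot, Finset.sum_mul, Finset.sum_eq_single i, mul_assoc, mul_star_mul_self (hproj i)]
    · intro j _ hj
      rw [mul_assoc, horth j i hj, mul_zero]
    · simp
  · have hzg : star z * g = star z := by
      have := congrArg star hgz
      rwa [star_mul, hg.isSelfAdjoint.star_eq] at this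
    simp only [Sum.elim_inr, Y]
    split_ifs
    · rw [mul_assoc, hzg]
    · simp

end MatrixUnits

/-! ### The facts about matrix algebras that are to be transferred. -/

section Matrices

open scoped Matrix.Norms.L2Operator
open Matrix

variable {N : ℕ}

/-- The matrix unit in the corner. -/
def corner (hN : 0 < N) : Matrix (Fin N) (Fin N) ℂ := single ⟨0, hN⟩ ⟨0, hN⟩ 1

theorem isStarProjection_corner (hN : 0 < N) : IsStarProjection (corner hN) := by
  refine ⟨?_, ?_⟩
  · simp [IsIdempotentElem, corner]
  · simp [IsSelfAdjoint, corner, star_eq_conjTranspose]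

theorem corner_ne_zero (hN : 0 < N) : corner hN ≠ 0 := fun h => by
  have := congrFun (congrFun h ⟨0, hN⟩) ⟨0, hN⟩
  simp [corner] at this

theorem norm_apply_diag_le (x : Matrix (Fin N) (Fin N) ℂ) (i : Fin N) : ‖x i i‖ ≤ ‖x‖ := by
  have e : (single i i 1 : Matrix (Fin N) (Fin N) ℂ) * x * single i i 1 =
      x i i • single i i 1 := by
    simp
  have hp : IsStarProjection (single i i 1 : Matrix (Fin N) (Fin N) ℂ) := by
    refine ⟨?_, ?_⟩
    · simp [IsIdempotentElem]
    · simp [IsSelfAdjoint, star_eq_conjTranspose]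
  have h0 : (single i i 1 : Matrix (Fin N) (Fin N) ℂ) ≠ 0 := fun h => by
    have := congrFun (congrFun h i) i
    simp at this
  have h1 := IsStarProjection.norm_eq_one hp h0
  have h2 := congrArg norm e
  rw [norm_smul, h1, mul_one] at h2
  rw [← h2]
  refine (norm_mul_le _ _).trans ?_
  rw [h1, mul_one]
  refine (norm_mul_le _ _).trans ?_
  rw [h1, one_mul]

theorem corner_mul_mul_corner (hN : 0 < N) (x : Matrix (Fin N) (Fin N) ℂ) :
    corner hN * x * corner hN = x ⟨0, hN⟩ ⟨0, hN⟩ • corner hN := by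
  simp [corner]

/-- The trace of $1-c$ is $N$, and a trace is at most $N$ times the norm. -/
theorem one_le_norm_one_sub_of_trace_eq_zero (hN : 0 < N) {c : Matrix (Fin N) (Fin N) ℂ}
    (hc : c.trace = 0) : 1 ≤ ‖1 - c‖ := by
  have h1 : (1 - c).trace = N := by simp [trace_sub, hc]
  have h2 : ‖(1 - c).trace‖ ≤ N * ‖1 - c‖ := by
    rw [trace]
    refine (norm_sum_le _ _).trans ((Finset.sum_le_sum fun i _ =>
      norm_apply_diag_le (1 - c) i).trans ?_)
    simp
  rw [h1] at h2
  simp only [Complex.norm_natCast] at h2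
  have : (0 : ℝ) < N := by exact_mod_cast hN
  nlinarith

/-- Every projection of a matrix algebra is a finite sum of copies of the corner. -/
theorem exists_isColumn (hN : 0 < N) {p : Matrix (Fin N) (Fin N) ℂ} (hp : IsStarProjection p) :
    ∃ (n : ℕ) (w : Fin n → Matrix (Fin N) (Fin N) ℂ), IsColumn (corner hN) w ∧
      p = ∑ i, w i * star (w i) := by
  classical
  have hH : p.IsHermitian := isHermitian_iff_isSelfAdjoint.mpr hp.isSelfAdjoint
  set U : Matrix (Fin N) (Fin N) ℂ := hH.eigenvectorUnitary.1 with hU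
  have hUU : star U * U = 1 := Unitary.coe_star_mul_self _
  have hev : ∀ i, hH.eigenvalues i = 0 ∨ hH.eigenvalues i = 1 := fun i => by
    have := hH.eigenvalues_mem_spectrum_real i
    have h2 := hp.isIdempotentElem.spectrum_subset ℝ this
    simpa using h2
  have hspec : p = U * diagonal (RCLike.ofReal ∘ hH.eigenvalues) * star U := by
    conv_lhs => rw [hH.spectral_theorem, Unitary.conjStarAlgAut_apply]
  let I := {i : Fin N // hH.eigenvalues i = 1}
  let v : Fin N → Matrix (Fin N) (Fin N) ℂ := fun i => U * single i ⟨0, hN⟩ 1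
  have hv : IsColumn (corner hN) v := by
    intro i j
    have e : star (v i) * v j = star (single i ⟨0, hN⟩ 1) * single j ⟨0, hN⟩ 1 := by
      simp only [v, star_mul, mul_assoc]
      rw [← mul_assoc (star U), hUU, one_mul]
    rw [e, star_eq_conjTranspose, conjTranspose_single]
    constructor
    · rintro rfl
      simp [corner]
    · intro h
      simp [h]
  refine ⟨Fintype.card I, fun k => v ((Fintype.equivFin I).symm k).1, fun i j => ?_, ?_⟩
  · refine ⟨fun h => (hv _ _).1 (by rw [h]), fun h => (hv _ _).2 ?_⟩
    rw [Ne, ← Subtype.ext_iff]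
    simpa using h
  · have e1 := (Fintype.equivFin I).symm.sum_comp fun i : I => v i.1 * star (v i.1)
    rw [e1]
    have e2 : ∀ i, v i * star (v i) = U * single i i 1 * star U := fun i => by
      simp only [v, star_mul, mul_assoc]
      rw [← mul_assoc (single i _ _), star_eq_conjTranspose (single _ _ _), conjTranspose_single]
      simp
    have e3 : (diagonal (RCLike.ofReal ∘ hH.eigenvalues) : Matrix (Fin N) (Fin N) ℂ) =
        ∑ i, if hH.eigenvalues i = 1 then single i i 1 else 0 := by
      rw [← sum_single_eq_diagonal]
      refine Finset.sum_congr rfl fun i _ => ?_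
      rcases hev i with h | h <;> simp [h]
    conv_lhs => rw [hspec, e3]
    rw [← Finset.sum_filter, Finset.mul_sum, Finset.sum_mul]
    simp only [e2]
    exact (Finset.sum_subtype (p := fun i => hH.eigenvalues i = 1) _ (by simp) _)

theorem mvnLE_or_mvnLE_matrix (hN : 0 < N) {p q : Matrix (Fin N) (Fin N) ℂ}
    (hp : IsStarProjection p) (hq : IsStarProjection q) : MvNLE p q ∨ MvNLE q p := by
  obtain ⟨n, w, hw, rfl⟩ := exists_isColumn hN hp
  obtain ⟨m, z, hz, rfl⟩ := exists_isColumn hN hq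
  rcases le_total n m with h | h
  · exact .inl (hw.mvnLE (isStarProjection_corner hN) hz (Fin.castLEEmb h))
  · exact .inr (hz.mvnLE (isStarProjection_corner hN) hw (Fin.castLEEmb h))

/-- For the spectral projection $q$ of $[0,\infty)$ the spectrum of $y-q$ lies in $[-1,0]$; the
shift by $1/2$ centres it. The spectrum being finite, every function is admissible in the calculus.
-/
theorem exists_projection_norm_sub_le (y : Matrix (Fin N) (Fin N) ℂ) (hy : IsSelfAdjoint y)
    (h1 : ‖y‖ ≤ 1) : ∃ q : Matrix (Fin N) (Fin N) ℂ, IsStarProjection q ∧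
      ‖y - q + (1 / 2 : ℂ) • (1 : Matrix (Fin N) (Fin N) ℂ)‖ ≤ 1 / 2 := by
  have hc : ∀ f : ℝ → ℝ, ContinuousOn f (spectrum ℝ y) := fun f =>
    (Matrix.finite_real_spectrum (A := y)).continuousOn f
  let F : ℝ → ℝ := fun t => if 0 ≤ t then 1 else 0
  refine ⟨cfc F y, ⟨?_, cfc_predicate F y⟩, ?_⟩
  · rw [IsIdempotentElem, ← cfc_mul F F y (hc _) (hc _)]
    congr 1
    funext t
    simp only [F]
    split_ifs <;> simp
  · have e : y - cfc F y + (1 / 2 : ℂ) • (1 : Matrix (Fin N) (Fin N) ℂ) =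
        cfc (fun t : ℝ => t - F t + 1 / 2) y := by
      rw [cfc_add y (fun t => t - F t) (fun _ => 1 / 2) (hc _) (hc _),
        cfc_sub (fun t => t) F y (hc _) (hc _), cfc_id' ℝ y, cfc_const _ y]
      congr 1
      ext i j
      by_cases h : i = j <;> simp [h, Algebra.algebraMap_eq_smul_one]
    rw [e]
    refine norm_cfc_le (by norm_num) fun t ht => ?_
    have ht1 : |t| ≤ 1 := (spectrum.norm_le_norm_mul_of_mem ht).trans (by
      refine (mul_le_mul_of_nonneg_right h1 (norm_nonneg _)).trans ?_
      rw [one_mul]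
      exact IsStarProjection.norm_le _ (.one _))
    rw [abs_le] at ht1
    rw [Real.norm_eq_abs, abs_le]
    simp only [F]
    split_ifs <;> constructor <;> linarith

end Matrices

/-! ### Unit, comparability, corners, approximation and commutators in $A$. -/

section Consequences

variable {A : Type*} [NonUnitalCStarAlgebra A]

open scoped Matrix.Norms.L2Operator

/-- Transfer gives an approximate left unit on the ball, and this is close to a projection $e$ with
$\|ey-y\|\le1/2$ there. As $e$ annihilates $ey-y$, applying the estimate to the normalised $ey-y$
forces it to vanish. -/
theorem IsPseudomatricial.exists_unit (hA : IsPseudomatricial A) :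
    ∃ e : A, IsStarProjection e ∧ ∀ y, e * y = y ∧ y * e = y := by
  let U : Poly₂ Unit Unit := fstVar Unit ()
  let Y : Poly₂ Unit Unit := sndVar Unit ()
  obtain ⟨u, hu, h⟩ := hA.exists_forall (ι := Unit) (κ := Unit) (J := Unit)
    (fun _ => (U.mul Y).sub Y) (fun r => r ()) (by fun_prop)
    (fun N hN => ⟨fun _ => 1, fun _ => IsStarProjection.norm_le _ (.one _), fun y _ => by
      simp only [U, Y, StarPoly.eval_sub, StarPoly.eval_mul, eval_fstVar, eval_sndVar, one_mul,
        sub_self, norm_zero, le_refl]⟩) (ε := 1 / 16) (by norm_num)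
  replace h : ∀ y : A, ‖y‖ ≤ 1 → ‖u () * y - y‖ ≤ 1 / 16 := fun y hy => by
    have := h (fun _ => y) (fun _ => hy)
    simp only [U, Y, StarPoly.eval_sub, StarPoly.eval_mul, eval_fstVar, eval_sndVar] at this
    exact this.le
  have hus : ‖star (u ())‖ ≤ 1 := by simpa using hu ()
  generalize u () = u at *
  -- The test element $y=u^*$ gives $uu^*\approx u^*$.
  obtain ⟨e, he, hd⟩ := exists_projection_near (x := star u) (δ := 1 / 16) hus le_rfl
    (by simpa using h (star u) hus)
  have hd' : ‖e - u‖ ≤ 5 / 16 := by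
    rw [← norm_star, star_sub, he.isSelfAdjoint.star_eq]
    linarith
  have hey : ∀ y : A, ‖y‖ ≤ 1 → ‖e * y - y‖ ≤ 1 / 2 := fun y hy => by
    have e1 : e * y - y = (e - u) * y + (u * y - y) := by
      rw [sub_mul]
      abel
    rw [e1]
    have h1 := norm_add_le ((e - u) * y) (u * y - y)
    have h2 := (norm_mul_le (e - u) y).trans (mul_le_of_le_one_right (norm_nonneg _) hy)
    have h3 := h y hy
    linarith
  have hl : ∀ y : A, e * y = y := fun y => by
    by_contra hne
    have hz : e * y - y ≠ 0 := sub_ne_zero.mpr hne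
    have hz0 : e * (e * y - y) = 0 := by
      rw [mul_sub, ← mul_assoc, he.isIdempotentElem.eq, sub_self]
    have hn : ‖((‖e * y - y‖⁻¹ : ℝ) : ℂ) • (e * y - y)‖ = 1 := by
      rw [norm_smul, Complex.norm_real, norm_inv, norm_norm,
        inv_mul_cancel₀ (norm_ne_zero_iff.mpr hz)]
    have := hey _ hn.le
    rw [mul_smul_comm, hz0, smul_zero, zero_sub, norm_neg, hn] at this
    norm_num at this
  refine ⟨e, he, fun y => ⟨hl y, ?_⟩⟩
  have := congrArg star (hl (star y))
  rwa [star_mul, star_star, he.isSelfAdjoint.star_eq] at this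

/-- Projections of a pseudomatricial algebra are comparable. -/
theorem IsPseudomatricial.mvnLE_or_mvnLE (hA : IsPseudomatricial A) {p q : A}
    (hp : IsStarProjection p) (hq : IsStarProjection q) : MvNLE p q ∨ MvNLE q p := by
  let P : Poly₂ (Fin 2) Unit := fstVar Unit 0
  let Q : Poly₂ (Fin 2) Unit := fstVar Unit 1
  let V : Poly₂ (Fin 2) Unit := sndVar (Fin 2) ()
  obtain ⟨v, hv, h⟩ := hA.forall_exists (ι := Fin 2) (κ := Unit) (J := Fin 6)
    ![(P.adj.mul P).sub P, (Q.adj.mul Q).sub Q, (Q.mul V).sub V, (V.mul P).sub V,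
      (V.adj.mul V).sub P, (V.mul V.adj).sub Q]
    -- The outer minimum is an implication: its first entry is nonpositive when the inputs are not
    -- nearly projections. At genuine projections that entry equals $1/1000$, the $\varepsilon$
    -- chosen below, so the second entry must be small. The inner minimum is the disjunction of the
    -- two subequivalences; in the second case $v$ is the adjoint of the witness.
    (fun r => min (1 / 1000 - r 0 - r 1) (max (max (r 2) (r 3)) (min (r 4) (r 5)) - 1 / 200))
    (by fun_prop) (fun N hN x hx => by
      simp only [P, Q, V, Matrix.cons_val, StarPoly.eval_sub, StarPoly.eval_mul,
        StarPoly.eval_adj, eval_fstVar, eval_sndVar]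
      generalize x 0 = p, x 1 = q, hx 0 = hp, hx 1 = hq
      by_cases hc : 1 / 1000 ≤ ‖star p * p - p‖ + ‖star q * q - q‖
      · exact ⟨0, by simp, min_le_of_left_le (by linarith)⟩
      rw [not_le] at hc
      obtain ⟨p', hp', hpd⟩ := exists_projection_near hp (δ := 1 / 1000) (by norm_num)
        (by linarith [norm_nonneg (star q * q - q)])
      obtain ⟨q', hq', hqd⟩ := exists_projection_near hq (δ := 1 / 1000) (by norm_num)
        (by linarith [norm_nonneg (star p * p - p)])
      have key : ∀ v : Matrix (Fin N) (Fin N) ℂ, ‖v‖ ≤ 1 → q' * v = v → v * p' = v →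
          ‖q * v - v‖ ≤ 1 / 200 ∧ ‖v * p - v‖ ≤ 1 / 200 := fun v hv h1 h2 => by
        constructor
        · nth_rewrite 2 [← h1]
          rw [← sub_mul]
          exact (norm_mul_le _ _).trans ((mul_le_of_le_one_right (norm_nonneg _) hv).trans
            (by rw [norm_sub_rev]; linarith))
        · nth_rewrite 2 [← h2]
          rw [← mul_sub]
          exact (norm_mul_le _ _).trans ((mul_le_of_le_one_left (norm_nonneg _) hv).trans
            (by rw [norm_sub_rev]; linarith))
      rcases mvnLE_or_mvnLE_matrix hN hp' hq' with ⟨v, h1, h2⟩ | ⟨v, h1, h2⟩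
      · have hvp : IsStarProjection (star v * v) := h1 ▸ hp'
        have hv := norm_le_one_of_star_mul_self hvp
        have h3 : v * p' = v := h1 ▸ mul_star_mul_self hvp
        have h4 : q' * v = v := by
          conv_rhs => rw [← mul_star_mul_self hvp, ← mul_assoc, ← h2]
          rw [mul_assoc, mul_assoc v, mul_star_mul_self hvp]
        obtain ⟨k1, k2⟩ := key v hv h4 h3
        refine ⟨fun _ => v, fun _ => hv, min_le_of_right_le (sub_nonpos.mpr
          (max_le (max_le k1 k2) (min_le_of_left_le ?_)))⟩
        rw [h1]
        linarith
      · have hvp : IsStarProjection (star v * v) := h1 ▸ hq'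
        have hv := norm_le_one_of_star_mul_self hvp
        have h3 : v * q' = v := h1 ▸ mul_star_mul_self hvp
        have h4 : p' * v = v := by
          conv_rhs => rw [← mul_star_mul_self hvp, ← mul_assoc, ← h2]
          rw [mul_assoc, mul_assoc v, mul_star_mul_self hvp]
        have h3' : q' * star v = star v := by
          have := congrArg star h3
          rwa [star_mul, hq'.isSelfAdjoint.star_eq] at this
        have h4' : star v * p' = star v := by
          have := congrArg star h4
          rwa [star_mul, hp'.isSelfAdjoint.star_eq] at this
        have hv' : ‖star v‖ ≤ 1 := by rwa [norm_star]
        obtain ⟨k1, k2⟩ := key (star v) hv' h3' h4'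
        refine ⟨fun _ => star v, fun _ => hv', min_le_of_right_le (sub_nonpos.mpr
          (max_le (max_le k1 k2) (min_le_of_right_le ?_)))⟩
        rw [star_star, h1]
        linarith)
    (ε := 1 / 1000) (by norm_num) ![p, q] (by
      intro i
      fin_cases i
      · exact hp.norm_le
      · exact hq.norm_le)
  simp only [P, Q, V, Matrix.cons_val, StarPoly.eval_sub, StarPoly.eval_mul,
    StarPoly.eval_adj, eval_fstVar, eval_sndVar, hp.isSelfAdjoint.star_eq,
    hq.isSelfAdjoint.star_eq, hp.isIdempotentElem.eq, hq.isIdempotentElem.eq, sub_self, norm_zero,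
    sub_zero, min_lt_iff, lt_self_iff_false, false_or] at h
  generalize v () = v, hv () = hv at *
  rw [sub_lt_iff_lt_add, max_lt_iff, max_lt_iff, min_lt_iff] at h
  obtain ⟨⟨h1, h2⟩, h3 | h3⟩ := h
  · exact .inl (mvnLE_of_near hp hq hv (c := 1 / 100) le_rfl (by linarith) (by linarith)
      (by linarith))
  · refine .inr (mvnLE_of_near hq hp (v := star v) (by rwa [norm_star]) (c := 1 / 100) le_rfl
      ?_ ?_ ?_)
    · rw [← norm_star]
      simp only [star_sub, star_mul, star_star, hp.isSelfAdjoint.star_eq]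
      linarith
    · rw [← norm_star]
      simp only [star_sub, star_mul, star_star, hq.isSelfAdjoint.star_eq]
      linarith
    · rw [star_star]
      linarith

/-- A pseudomatricial algebra has projections with almost one-dimensional corner. -/
theorem IsPseudomatricial.exists_corner_near (hA : IsPseudomatricial A) {η : ℝ} (hη : 0 < η) :
    ∃ f : A, IsStarProjection f ∧ f ≠ 0 ∧
      ∀ x : A, ‖x‖ ≤ 1 → ∃ c : ℂ, ‖f * x * f - c • f‖ ≤ 3 * η := by
  -- Scalars cannot be quantified in the language. A finite $\eta$-net of the disc replaces "some
  -- $c$" by a finite disjunction, encoded as the vanishing of a product of positive parts.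
  obtain ⟨T, hT, hTf, hcov⟩ := (isCompact_closedBall (0 : ℂ) 1).finite_cover_balls hη
  have : Fintype T := hTf.fintype
  let F : Poly₂ Unit Unit := fstVar Unit ()
  let X : Poly₂ Unit Unit := sndVar Unit ()
  -- The bound $\eta/15$ makes the three errors of replacing $f$ by a projection, $5\varepsilon$
  -- each, add up to at most $\eta$. The bound $\eta^{|T|}$ ensures that some factor of the product
  -- is below $\eta$.
  let ε := min (min (1 / 16) (η / 15)) (η ^ Fintype.card T)
  have hε : 0 < ε := lt_min (lt_min (by norm_num) (by positivity)) (by positivity)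
  have hε1 : ε ≤ 1 / 16 := (min_le_left _ _).trans (min_le_left _ _)
  have hε2 : ε ≤ η / 15 := (min_le_left _ _).trans (min_le_right _ _)
  have hε3 : ε ≤ η ^ Fintype.card T := min_le_right _ _
  obtain ⟨f, hf, h⟩ := hA.exists_forall (ι := Unit) (κ := Unit) (J := Bool ⊕ T)
    (Sum.elim (fun b => if b then (F.adj.mul F).sub F else F)
      fun c => ((F.mul X).mul F).sub (.smul c F))
    (fun r => max (max (r (.inl true)) (1 - r (.inl false)))
      (∏ c : T, max 0 (r (.inr c) - η))) (by fun_prop)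
    (fun N hN => by
      have hc := isStarProjection_corner hN
      have h1 := IsStarProjection.norm_eq_one hc (corner_ne_zero hN)
      refine ⟨fun _ => corner hN, fun _ => h1.le, fun y hy => ?_⟩
      simp only [F, X, Sum.elim_inl, Sum.elim_inr, if_true, Bool.false_eq_true, if_false,
        StarPoly.eval_sub, StarPoly.eval_mul, StarPoly.eval_smul,
        StarPoly.eval_adj, eval_fstVar, eval_sndVar, hc.isSelfAdjoint.star_eq,
        hc.isIdempotentElem.eq, sub_self, norm_zero, h1, max_self, corner_mul_mul_corner]
      refine max_le le_rfl (le_of_eq ?_)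
      have hm : y () ⟨0, hN⟩ ⟨0, hN⟩ ∈ Metric.closedBall (0 : ℂ) 1 :=
        mem_closedBall_zero_iff.mpr ((norm_apply_diag_le _ _).trans (hy ()))
      obtain ⟨c, hcT, hcb⟩ := Set.mem_iUnion₂.mp (hcov hm)
      refine Finset.prod_eq_zero (Finset.mem_univ (⟨c, hcT⟩ : T)) ?_
      rw [← sub_smul, norm_smul, h1, mul_one, max_eq_left]
      rw [Metric.mem_ball, dist_eq_norm] at hcb
      linarith) hε
  simp only [F, X, Sum.elim_inl, Sum.elim_inr, if_true, Bool.false_eq_true, if_false,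
    StarPoly.eval_sub, StarPoly.eval_mul, StarPoly.eval_smul, StarPoly.eval_adj, eval_fstVar,
    eval_sndVar, max_lt_iff] at h
  generalize f () = f, hf () = hf at *
  have h0 := (h 0 (by simp)).1
  obtain ⟨g, hg, hgf⟩ := exists_projection_near hf hε1 h0.1.le
  refine ⟨g, hg, ?_, fun x hx => ?_⟩
  · rintro rfl
    rw [zero_sub, norm_neg] at hgf
    linarith [h0.2]
  · have h1 := (h (fun _ => x) fun _ => hx).2
    obtain ⟨c, hc⟩ : ∃ c : T, ‖f * x * f - (c : ℂ) • f‖ < 2 * η := by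
      by_contra! hcon
      refine absurd h1 (not_lt.mpr (hε3.trans ?_))
      rw [← Finset.card_univ, ← Finset.prod_const]
      exact Finset.prod_le_prod (fun _ _ => hη.le) fun c _ =>
        le_max_of_le_right (by linarith [hcon c])
    refine ⟨c, ?_⟩
    have hcn : ‖(c : ℂ)‖ ≤ 1 := mem_closedBall_zero_iff.mp (hT c.2)
    have e : g * x * g - (c : ℂ) • g = (g * x * g - f * x * f) + (f * x * f - (c : ℂ) • f) -
        (c : ℂ) • (g - f) := by
      rw [smul_sub]
      abel
    have i1 : ‖g * x * g - f * x * f‖ ≤ ‖g * x - f * x‖ + ‖g - f‖ :=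
      norm_mul_sub_mul_le hg.norm_le ((norm_mul_le _ _).trans
        (mul_le_one₀ hf (norm_nonneg _) hx))
    have i2 : ‖g * x - f * x‖ ≤ ‖g - f‖ := by
      rw [← sub_mul]
      exact (norm_mul_le _ _).trans (mul_le_of_le_one_right (norm_nonneg _) hx)
    have i3 : ‖(c : ℂ) • (g - f)‖ ≤ ‖g - f‖ := by
      rw [norm_smul]
      exact mul_le_of_le_one_left (norm_nonneg _) hcn
    rw [e]
    have i4 := norm_sub_le ((g * x * g - f * x * f) + (f * x * f - (c : ℂ) • f))
      ((c : ℂ) • (g - f))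
    have i5 := norm_add_le (g * x * g - f * x * f) (f * x * f - (c : ℂ) • f)
    linarith

/-- The language has no unit, so the shift by $1/2$ uses a second existential projection, which is
$1$ in matrices. All that matters is that the bound stays below $1$, so that the approximation can
be iterated. -/
theorem IsPseudomatricial.exists_projections_near (hA : IsPseudomatricial A) {x : A}
    (hx : IsSelfAdjoint x) (h1 : ‖x‖ ≤ 1) : ∃ q q' : A, IsStarProjection q ∧
      IsStarProjection q' ∧ ‖x - q + (1 / 2 : ℂ) • q'‖ ≤ 3 / 4 := by
  let X : Poly₂ Unit (Fin 2) := fstVar (Fin 2) ()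
  let Q : Poly₂ Unit (Fin 2) := sndVar Unit 0
  let Q' : Poly₂ Unit (Fin 2) := sndVar Unit 1
  -- Quantifiers range over all contractions, so the formula uses the self-adjoint part of the
  -- variable.
  obtain ⟨y, hy, h⟩ := hA.forall_exists (ι := Unit) (κ := Fin 2) (J := Fin 3)
    ![(Q.adj.mul Q).sub Q, (Q'.adj.mul Q').sub Q',
      ((StarPoly.smul (1 / 2) (X.add X.adj)).sub Q).add (.smul (1 / 2) Q')]
    (fun r => max (max (r 0) (r 1)) (r 2 - 1 / 2)) (by fun_prop)
    (fun N hN x hx => by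
      simp only [X, Q, Q', Matrix.cons_val, StarPoly.eval_sub, StarPoly.eval_mul,
        StarPoly.eval_add, StarPoly.eval_smul, StarPoly.eval_adj, eval_fstVar, eval_sndVar]
      generalize x () = x, hx () = hx
      have hs : IsSelfAdjoint ((1 / 2 : ℂ) • (x + star x)) := by
        simp [IsSelfAdjoint, star_smul, add_comm]
      have hn : ‖(1 / 2 : ℂ) • (x + star x)‖ ≤ 1 := by
        rw [norm_smul]
        have := norm_add_le x (star x)
        rw [norm_star] at this
        norm_num
        linarith
      obtain ⟨q, hq, hle⟩ := exists_projection_norm_sub_le _ hs hn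
      refine ⟨![q, 1], ?_, ?_⟩
      · intro i
        fin_cases i
        · exact hq.norm_le
        · exact IsStarProjection.norm_le _ (.one _)
      · simp only [Matrix.cons_val, hq.isSelfAdjoint.star_eq, hq.isIdempotentElem.eq, star_one,
          mul_one, sub_self, norm_zero, max_self]
        exact max_le le_rfl (by linarith))
    (ε := 1 / 100) (by norm_num) (fun _ => x) (fun _ => h1)
  simp only [X, Q, Q', Matrix.cons_val, StarPoly.eval_sub, StarPoly.eval_mul,
    StarPoly.eval_add, StarPoly.eval_smul, StarPoly.eval_adj, eval_fstVar, eval_sndVar,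
    max_lt_iff, hx.star_eq] at h
  obtain ⟨⟨h2, h3⟩, h4⟩ := h
  obtain ⟨q, hq, hqd⟩ := exists_projection_near (hy 0) (by norm_num) h2.le
  obtain ⟨q', hq', hqd'⟩ := exists_projection_near (hy 1) (by norm_num) h3.le
  refine ⟨q, q', hq, hq', ?_⟩
  have e : x - q + (1 / 2 : ℂ) • q' = ((1 / 2 : ℂ) • (x + x) - y 0 + (1 / 2 : ℂ) • y 1) -
      (q - y 0) + (1 / 2 : ℂ) • (q' - y 1) := by
    rw [← two_smul ℂ x, smul_smul, smul_sub]
    norm_num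
    abel
  rw [e]
  have i1 := norm_add_le (((1 / 2 : ℂ) • (x + x) - y 0 + (1 / 2 : ℂ) • y 1) - (q - y 0))
    ((1 / 2 : ℂ) • (q' - y 1))
  have i2 := norm_sub_le ((1 / 2 : ℂ) • (x + x) - y 0 + (1 / 2 : ℂ) • y 1) (q - y 0)
  have i3 : ‖(1 / 2 : ℂ) • (q' - y 1)‖ = 1 / 2 * ‖q' - y 1‖ := by
    rw [norm_smul]
    norm_num
  linarith

/-- The transferred form of the distance from $1$ to trace-zero matrices, with the contraction $y$
standing in for the unit missing from the language. -/
theorem IsPseudomatricial.exists_one_sub_lt_norm (hA : IsPseudomatricial A) {k : ℕ} (M : ℂ)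
    (a b : Fin k → A) (ha : ∀ i, ‖a i‖ ≤ 1) (hb : ∀ i, ‖b i‖ ≤ 1) {ε : ℝ} (hε : 0 < ε) :
    ∃ y : A, ‖y‖ ≤ 1 ∧ 1 - ε < ‖y - (M • ∑ i, (a i * b i - b i * a i)) * y‖ := by
  let X : Fin k → Poly₂ (Fin k × Bool) Unit := fun i => fstVar Unit (i, true)
  let X' : Fin k → Poly₂ (Fin k × Bool) Unit := fun i => fstVar Unit (i, false)
  let Y : Poly₂ (Fin k × Bool) Unit := sndVar (Fin k × Bool) ()
  obtain ⟨y, hy, h⟩ := hA.forall_exists (ι := Fin k × Bool) (κ := Unit) (J := Unit)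
    (fun _ => Y.sub (.mul (.smul M (.sum fun i => ((X i).mul (X' i)).sub ((X' i).mul (X i)))) Y))
    (fun r => 1 - r ()) (by fun_prop)
    (fun N hN x hx => by
      refine ⟨fun _ => 1, fun _ => IsStarProjection.norm_le _ (.one _), ?_⟩
      simp only [X, X', Y, StarPoly.eval_sub, StarPoly.eval_mul, StarPoly.eval_sum,
        StarPoly.eval_smul, eval_fstVar, eval_sndVar, mul_one]
      have := one_le_norm_one_sub_of_trace_eq_zero hN
        (c := M • ∑ i, (x (i, true) * x (i, false) - x (i, false) * x (i, true))) (by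
          simp [Matrix.trace_sum, Matrix.trace_sub, Matrix.trace_smul,
            Matrix.trace_mul_comm (x (_, true))])
      linarith)
    hε (fun i => if i.2 then a i.1 else b i.1) (fun i => by
      split_ifs
      · exact ha _
      · exact hb _)
  simp only [X, X', Y, StarPoly.eval_sub, StarPoly.eval_mul, StarPoly.eval_sum,
    StarPoly.eval_smul, eval_fstVar, eval_sndVar, if_true, Bool.false_eq_true, if_false] at h
  exact ⟨y (), hy (), by linarith⟩

end Consequences

/-! ### Approximate fractions of projections. -/

section Division

variable {A : Type*} [NonUnitalCStarAlgebra A]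

theorem isStarProjection_sum {ι : Type*} (s : Finset ι) {e : ι → A}
    (he : ∀ i ∈ s, IsStarProjection (e i)) (ho : ∀ i ∈ s, ∀ j ∈ s, i ≠ j → e i * e j = 0) :
    IsStarProjection (∑ i ∈ s, e i) := by
  classical
  induction s using Finset.induction_on with
  | empty => simp
  | insert a s ha ih =>
    rw [Finset.sum_insert ha]
    refine (he a (Finset.mem_insert_self a s)).add (ih (fun i hi =>
      he i (Finset.mem_insert_of_mem hi)) fun i hi j hj =>
      ho i (Finset.mem_insert_of_mem hi) j (Finset.mem_insert_of_mem hj)) ?_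
    rw [Finset.mul_sum]
    exact Finset.sum_eq_zero fun i hi => ho a (Finset.mem_insert_self a s) i
      (Finset.mem_insert_of_mem hi) fun h => ha (h ▸ hi)

/-- Conjugation by $v$ carries a subprojection $r$ of $q$ to the subprojection $v^*rv$ of $p$, from
which $r$ is recovered. -/
theorem IsMinimalProjection.of_equiv {p q : A} (hp : IsMinimalProjection p) (h : MvNEquiv p q) :
    IsMinimalProjection q := by
  have hq := h.isStarProjection hp.1
  obtain ⟨v, h1, h2⟩ := h
  have hv : IsStarProjection (star v * v) := h1 ▸ hp.1
  refine ⟨hq, ?_, fun r hr hqr => ?_⟩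
  · rintro rfl
    rw [CStarRing.mul_star_self_eq_zero_iff] at h2
    exact hp.2.1 (by rw [← h1, h2, mul_zero])
  · have hrq : r * q = r := IsStarProjection.mul_comm_of_mul_eq hq hr hqr
    have e1 : v * (star v * r * v) * star v = r := by
      rw [mul_assoc (star v), ← mul_assoc v, h2, mul_assoc q, mul_assoc r, h2, hrq, hqr]
    have h3 : IsStarProjection (star v * r * v) := by
      refine ⟨?_, ?_⟩
      · rw [IsIdempotentElem]
        calc star v * r * v * (star v * r * v) = star v * (r * (v * star v) * r) * v := by
              simp only [mul_assoc]
          _ = star v * r * v := by rw [h2, hrq, hr.isIdempotentElem.eq]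
      · simp [IsSelfAdjoint, hr.isSelfAdjoint.star_eq, mul_assoc]
    have h4 : p * (star v * r * v) = star v * r * v := by
      rw [← h1, mul_assoc (star v) r, ← mul_assoc _ (star v), mul_assoc (star v) v,
        star_mul_star_mul_self hv]
    rcases hp.2.2 _ h3 h4 with h5 | h5
    · left
      rw [← e1, h5, mul_zero, zero_mul]
    · right
      rw [← e1, h5, ← h1, mul_star_mul_self hv, h2]

open scoped Matrix.Norms.L2Operator in
theorem IsPseudomatricial.exists_division_near (hA : IsPseudomatricial A) {p f : A}
    (hp : IsStarProjection p) (hf : IsStarProjection f) (hf0 : f ≠ 0) {d : ℕ} (hd : 1 ≤ d)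
    {c : ℝ} (hc : 0 < c) : ∃ x : Fin d ⊕ Fin (d - 1) → A, (∀ i, ‖x i‖ ≤ 1) ∧
      (∀ i j, i ≠ j → ‖star (x i) * x j‖ ≤ c) ∧
      (∀ i, ‖star (x i) * x i * (star (x i) * x i) - star (x i) * x i‖ ≤ c) ∧
      (∀ i, ‖p * x i - x i‖ ≤ c) ∧
      (∀ i j, ‖star (x (.inl i)) * x (.inl i) - star (x (.inl j)) * x (.inl j)‖ ≤ c) ∧
      (∀ j, ‖x (.inr j) * f - x (.inr j)‖ ≤ c) ∧
      ‖p - ∑ i, x i * star (x i)‖ ≤ c := by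
  let I := Fin d ⊕ Fin (d - 1)
  let P : Poly₂ (Fin 2) I := fstVar I 0
  let F : Poly₂ (Fin 2) I := fstVar I 1
  let X : I → Poly₂ (Fin 2) I := fun i => sndVar (Fin 2) i
  let K := (I × I) ⊕ I ⊕ I ⊕ (Fin d × Fin d) ⊕ Fin (d - 1) ⊕ Unit
  let S : I → Poly₂ (Fin 2) I := fun i => (X i).adj.mul (X i)
  let T : K → Poly₂ (Fin 2) I :=
    Sum.elim (fun i => if i.1 = i.2 then .zero else (X i.1).adj.mul (X i.2)) <|
    Sum.elim (fun i => ((S i).mul (S i)).sub (S i)) <|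
    Sum.elim (fun i => (P.mul (X i)).sub (X i)) <|
    Sum.elim (fun i => (S (.inl i.1)).sub (S (.inl i.2))) <|
    Sum.elim (fun j => ((X (.inr j)).mul F).sub (X (.inr j)))
      fun _ => P.sub (.sum fun i => (X i).mul (X i).adj)
  let δ := min (1 / 100) (c / 10)
  have hδ : 0 < δ := lt_min (by norm_num) (by positivity)
  have hδ1 : δ ≤ 1 / 100 := min_le_left _ _
  have hδ2 : δ ≤ c / 10 := min_le_right _ _
  -- Implication again: the first entry of the minimum expresses that $p$, $f$ are nearly
  -- projections and $\|f\|\approx1$, and it equals $\delta$ at the given pair. The norm condition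
  -- makes the matrix projection near $f$ nonzero, so that it contains a copy of the corner.
  obtain ⟨x, hx, h⟩ := hA.forall_exists (ι := Fin 2) (κ := I) (J := Fin 3 ⊕ K)
    (Sum.elim ![(P.adj.mul P).sub P, (F.adj.mul F).sub F, F] T)
    (fun r => min (δ - r (.inl 0) - r (.inl 1) - |1 - r (.inl 2)|)
      (∑ j : K, max 0 (r (.inr j) - c / 2))) (by fun_prop)
    (fun N hN x hx => by
      simp only [Sum.elim_inl, Sum.elim_inr, P, F, Matrix.cons_val, StarPoly.eval_sub,
        StarPoly.eval_mul, StarPoly.eval_adj, eval_fstVar]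
      by_cases hcase : δ ≤ ‖star (x 0) * x 0 - x 0‖ + ‖star (x 1) * x 1 - x 1‖ + |1 - ‖x 1‖|
      · exact ⟨0, by simp, min_le_of_left_le (by linarith)⟩
      rw [not_le] at hcase
      have n1 := norm_nonneg (star (x 0) * x 0 - x 0)
      have n2 := norm_nonneg (star (x 1) * x 1 - x 1)
      have n3 := abs_nonneg (1 - ‖x 1‖)
      obtain ⟨p', hp', hpd⟩ := exists_projection_near (hx 0) (δ := δ) (by linarith)
        (by linarith)
      obtain ⟨f', hf', hfd⟩ := exists_projection_near (hx 1) (δ := δ) (by linarith)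
        (by linarith)
      obtain ⟨n, w, hw, rfl⟩ := exists_isColumn hN hp'
      obtain ⟨m, z, hz, rfl⟩ := exists_isColumn hN hf'
      have hm : 0 < m := by
        rcases Nat.eq_zero_or_pos m with rfl | h
        · rw [Finset.univ_eq_empty, Finset.sum_empty, zero_sub, norm_neg] at hfd
          have := le_abs_self (1 - ‖x 1‖)
          linarith
        · exact h
      have hcor := isStarProjection_corner hN
      obtain ⟨y, y1, y2, y3, y4, y5, y6⟩ := hw.exists_division hcor (∑ i, z i * star (z i))
        (z ⟨0, hm⟩) (hz.star_mul_self _) (hz.sum_mul hcor _) hf' d hd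
      have hyn : ∀ i, ‖y i‖ ≤ 1 := fun i => norm_le_one_of_star_mul_self (y1 i)
      rw [norm_sub_rev] at hpd hfd
      refine ⟨y, hyn, min_le_of_right_le (le_of_eq (Finset.sum_eq_zero fun j _ => ?_))⟩
      refine max_eq_left (sub_nonpos.mpr ?_)
      rcases j with i | i | i | i | i | i <;>
      simp only [T, S, P, F, X, Sum.elim_inl, Sum.elim_inr, StarPoly.eval_sub, StarPoly.eval_sum,
        StarPoly.eval_mul, StarPoly.eval_adj, eval_fstVar, eval_sndVar]
      · split_ifs with hi
        · simp only [StarPoly.eval_zero, norm_zero]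
          positivity
        · simp only [StarPoly.eval_mul, StarPoly.eval_adj, eval_sndVar, y2 _ _ hi, norm_zero]
          positivity
      · rw [(y1 i).isIdempotentElem.eq, sub_self, norm_zero]
        positivity
      · nth_rewrite 2 [← y3 i]
        rw [← sub_mul]
        refine (norm_mul_le _ _).trans ((mul_le_of_le_one_right (norm_nonneg _) (hyn i)).trans ?_)
        linarith
      · rw [y4 i.1 i.2, sub_self, norm_zero]
        positivity
      · nth_rewrite 2 [← y5 i]
        rw [← mul_sub]
        refine (norm_mul_le _ _).trans ((mul_le_of_le_one_left (norm_nonneg _) (hyn _)).trans ?_)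
        linarith
      · rw [y6]
        linarith)
    (ε := min δ (c / 2)) (lt_min hδ (by positivity)) ![p, f] (by
      intro i
      fin_cases i
      · exact hp.norm_le
      · exact hf.norm_le)
  simp only [Sum.elim_inl, Sum.elim_inr, P, F, Matrix.cons_val, StarPoly.eval_sub,
    StarPoly.eval_mul, StarPoly.eval_adj, eval_fstVar, hp.isSelfAdjoint.star_eq,
    hf.isSelfAdjoint.star_eq, hp.isIdempotentElem.eq, hf.isIdempotentElem.eq, sub_self, norm_zero,
    IsStarProjection.norm_eq_one hf hf0, abs_zero, sub_zero] at h
  have h1 : ∑ j : K, max 0 (‖(T j).eval (assign ![p, f] x)‖ - c / 2) < c / 2 := by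
    rcases min_lt_iff.mp h with h | h
    · exact absurd (min_le_left _ _) (not_le.mpr h)
    · exact h.trans_le (min_le_right _ _)
  have h2 : ∀ j : K, ‖(T j).eval (assign ![p, f] x)‖ ≤ c := fun j => by
    have := (Finset.single_le_sum (f := fun j : K =>
      max 0 (‖(T j).eval (assign ![p, f] x)‖ - c / 2)) (fun i _ => le_max_left _ _)
      (Finset.mem_univ j)).trans_lt h1
    have := (le_max_right 0 _).trans_lt this
    linarith
  refine ⟨x, hx, fun i j hij => ?_, fun i => ?_, fun i => ?_, fun i j => ?_, fun j => ?_, ?_⟩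
  · have := h2 (.inl (i, j))
    simpa only [T, X, Sum.elim_inl, if_neg hij, StarPoly.eval_mul, StarPoly.eval_adj,
      eval_sndVar] using this
  · have := h2 (.inr (.inl i))
    simpa only [T, S, X, Sum.elim_inl, Sum.elim_inr, StarPoly.eval_sub, StarPoly.eval_mul,
      StarPoly.eval_adj, eval_sndVar] using this
  · have := h2 (.inr (.inr (.inl i)))
    simpa only [T, P, X, Sum.elim_inl, Sum.elim_inr, StarPoly.eval_sub, StarPoly.eval_mul,
      StarPoly.eval_adj, eval_fstVar, eval_sndVar, Matrix.cons_val] using this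
  · have := h2 (.inr (.inr (.inr (.inl (i, j)))))
    simpa only [T, S, X, Sum.elim_inl, Sum.elim_inr, StarPoly.eval_sub, StarPoly.eval_mul,
      StarPoly.eval_adj, eval_sndVar] using this
  · have := h2 (.inr (.inr (.inr (.inr (.inl j)))))
    simpa only [T, F, X, Sum.elim_inl, Sum.elim_inr, StarPoly.eval_sub, StarPoly.eval_mul,
      StarPoly.eval_adj, eval_fstVar, eval_sndVar, Matrix.cons_val] using this
  · have := h2 (.inr (.inr (.inr (.inr (.inr ())))))
    simpa only [T, P, X, Sum.elim_inl, Sum.elim_inr, StarPoly.eval_sub, StarPoly.eval_mul,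
      StarPoly.eval_sum, StarPoly.eval_adj, eval_fstVar, eval_sndVar, Matrix.cons_val] using this

/-- Approximate fractions exist, provided that there is a minimal projection. -/
theorem IsPseudomatricial.exists_isApproxFraction (hA : IsPseudomatricial A) {p f : A}
    (hp : IsStarProjection p) (hf : IsMinimalProjection f) {d : ℕ} (hd : 1 ≤ d) :
    ∃ q : A, IsApproxFraction d q p := by
  classical
  let I := Fin d ⊕ Fin (d - 1)
  -- Small enough that the ranges add up to within distance less than $1$ of $p$, hence to $p$
  -- exactly, and that the sources of the main pieces are close enough to be equivalent.
  let η : ℝ := 1 / (4000 * (Fintype.card I + 1))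
  have hη : 0 < η := by positivity
  have hη1 : η ≤ 1 / 4000 := by
    refine one_div_le_one_div_of_le (by norm_num) ?_
    have : (0 : ℝ) ≤ Fintype.card I := Nat.cast_nonneg _
    linarith
  have hη2 : Fintype.card I * (2 * η) ≤ 1 / 2 := by
    have h1 : (4000 * ((Fintype.card I : ℝ) + 1)) * η = 1 := mul_one_div_cancel (by positivity)
    nlinarith
  obtain ⟨δ, hδ, H⟩ := exists_orthogonal_near (A := A) (Finset.univ : Finset I) η hη
  let c := min δ (1 / 4000)
  have hc : 0 < c := lt_min hδ (by norm_num)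
  have hc1 : c ≤ δ := min_le_left _ _
  have hc2 : c ≤ 1 / 4000 := min_le_right _ _
  obtain ⟨x, hx, x1, x2, x3, x4, x5, x6⟩ := hA.exists_division_near hp hf.1 hf.2.1 hd hc
  obtain ⟨y, hy, hyo⟩ := H p hp x (fun i _ => hx i) (fun i _ => (x2 i).trans hc1)
    (fun i _ => (x3 i).trans hc1) (fun i _ j _ hij => (x1 i j hij).trans hc1)
  have y1 := fun i => (hy i (Finset.mem_univ _)).1
  have y2 := fun i => (hy i (Finset.mem_univ _)).2.1
  have y3 := fun i => (hy i (Finset.mem_univ _)).2.2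
  have y4 := fun i j (h : i ≠ j) => hyo i (Finset.mem_univ _) j (Finset.mem_univ _) h
  have yn := fun i => norm_le_one_of_star_mul_self (y1 i)
  let e : I → A := fun i => y i * star (y i)
  have he : ∀ i, IsStarProjection (e i) := fun i => isStarProjection_mul_star (y1 i)
  have heo : ∀ i j, i ≠ j → e i * e j = 0 := fun i j h => by
    simp only [e]
    rw [mul_star_mul_mul_star, y4 i j h, mul_zero, zero_mul]
  have hsum : ∑ i, e i = p := by
    refine IsStarProjection.eq_of_norm_sub_lt hp (isStarProjection_sum _ (fun i _ => he i)
      fun i _ j _ => heo i j) ?_ ?_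
    · rw [Finset.mul_sum]
      exact Finset.sum_congr rfl fun i _ => by simp only [e, ← mul_assoc, y2]
    · have h1 : ‖∑ i, x i * star (x i) - ∑ i, e i‖ ≤ Fintype.card I * (2 * η) := by
        rw [← Finset.sum_sub_distrib]
        refine (norm_sum_le _ _).trans ((Finset.sum_le_card_nsmul _ _ (2 * η) fun i _ => ?_).trans
          (by rw [nsmul_eq_mul, Finset.card_univ]))
        refine (norm_mul_star_self_sub_le (hx i) (yn i)).trans ?_
        rw [norm_sub_rev]
        linarith [y3 i]
      have := norm_sub_le_norm_sub_add_norm_sub p (∑ i, x i * star (x i)) (∑ i, e i)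
      linarith
  have hequiv : ∀ i j, MvNEquiv (e (.inl i)) (e (.inl j)) := fun i j => by
    refine MvNEquiv.trans (y1 (.inl i)) (MvNEquiv.symm ⟨_, rfl, rfl⟩)
      (MvNEquiv.trans (y1 (.inl j)) ?_ ⟨_, rfl, rfl⟩)
    refine mvnEquiv_of_norm_sub_le (y1 _) (y1 _) ?_
    have h1 := norm_star_mul_self_sub_le (yn (.inl i)) (hx (.inl i))
    have h2 := norm_star_mul_self_sub_le (hx (.inl j)) (yn (.inl j))
    rw [norm_sub_rev (x (.inl j)) (y (.inl j))] at h2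
    have h3 := norm_sub_le_norm_sub_add_norm_sub (star (y (.inl i)) * y (.inl i))
      (star (x (.inl i)) * x (.inl i)) (star (y (.inl j)) * y (.inl j))
    have h4 := norm_sub_le_norm_sub_add_norm_sub (star (x (.inl i)) * x (.inl i))
      (star (x (.inl j)) * x (.inl j)) (star (y (.inl j)) * y (.inl j))
    linarith [x4 i j, y3 (.inl i), y3 (.inl j)]
  -- The source of a remainder piece is almost under $f$, hence subequivalent to $f$, and minimality
  -- of $f$ leaves two cases.
  have hmin : ∀ j, e (.inr j) = 0 ∨ IsMinimalProjection (e (.inr j)) := fun j => by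
    set g := star (y (.inr j)) * y (.inr j) with hg
    have hgp : IsStarProjection g := y1 (.inr j)
    have hyf : ‖y (.inr j) * f - y (.inr j)‖ ≤ 1 / 100 := by
      have e1 : y (.inr j) * f - y (.inr j) = (y (.inr j) - x (.inr j)) * f +
          (x (.inr j) * f - x (.inr j)) - (y (.inr j) - x (.inr j)) := by
        rw [sub_mul]
        abel
      rw [e1]
      have i1 := norm_sub_le ((y (.inr j) - x (.inr j)) * f + (x (.inr j) * f - x (.inr j)))
        (y (.inr j) - x (.inr j))
      have i2 := norm_add_le ((y (.inr j) - x (.inr j)) * f) (x (.inr j) * f - x (.inr j))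
      have i3 := (norm_mul_le (y (.inr j) - x (.inr j)) f).trans
        (mul_le_of_le_one_right (norm_nonneg _) hf.1.norm_le)
      linarith [x5 j, y3 (.inr j)]
    have hgf : ‖f * g - g‖ ≤ 1 / 100 := by
      rw [← norm_star, star_sub, star_mul, hgp.isSelfAdjoint.star_eq,
        hf.1.isSelfAdjoint.star_eq, hg, mul_assoc, ← mul_sub]
      exact (norm_mul_le _ _).trans ((mul_le_of_le_one_left (norm_nonneg _)
        (by rw [norm_star]; exact yn _)).trans hyf)
    have hle : MvNLE g f := mvnLE_of_near hgp hf.1 hgp.norm_le (c := 1 / 100) le_rfl hgf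
      (by rw [hgp.isIdempotentElem.eq, sub_self, norm_zero]; norm_num)
      (by rw [hgp.isSelfAdjoint.star_eq, hgp.isIdempotentElem.eq, sub_self, norm_zero]; norm_num)
    have hge : MvNEquiv g (e (.inr j)) := ⟨_, rfl, rfl⟩
    obtain ⟨r, hr, hgr, hfr⟩ := hle.exists_equiv hgp
    rcases hf.2.2 r hr hfr with rfl | rfl
    · rw [hgr.eq_zero] at hge
      exact .inl hge.symm.eq_zero
    · exact .inr (hf.of_equiv (MvNEquiv.trans hgp hgr.symm hge))
  let M := {j : Fin (d - 1) // e (.inr j) ≠ 0}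
  have hMc : Fintype.card M < d := by
    have := Fintype.card_subtype_le fun j : Fin (d - 1) => e (.inr j) ≠ 0
    rw [Fintype.card_fin] at this
    exact lt_of_le_of_lt this (by omega)
  refine ⟨e (.inl ⟨0, hd⟩), Fintype.card M, fun i => e (.inl i),
    fun k => e (.inr ((Fintype.equivFin M).symm k).1), hMc, fun i => he _, fun k => ?_,
    fun i j h => heo _ _ (Sum.inl_injective.ne h), fun i j h => heo _ _ ?_,
    fun i j => heo _ _ (by simp), fun i => hequiv _ _, ⟨_, rfl⟩, ?_⟩
  · exact (hmin _).resolve_left ((Fintype.equivFin M).symm k).2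
  · rw [Ne, Sum.inr.injEq, ← Subtype.ext_iff]
    simpa using h
  · rw [← hsum, Fintype.sum_sum_type,
      (Fintype.equivFin M).symm.sum_comp fun m : M => e (.inr m.1)]
    congr 1
    rw [← Finset.sum_filter_ne_zero]
    exact Finset.sum_subtype (p := fun j => e (.inr j) ≠ 0) _ (by simp) _

end Division

/-! ### Packings by copies, minimal projections and density of their span. -/

section Packings

variable {A : Type*} [NonUnitalCStarAlgebra A]

/-- `e` is a family of mutually orthogonal copies of `g` below `p`. -/
structure IsPacking {n : ℕ} (g p : A) (e : Fin n → A) : Prop where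
  proj : ∀ i, IsStarProjection (e i)
  orth : ∀ i j, i ≠ j → e i * e j = 0
  equiv : ∀ i, MvNEquiv g (e i)
  le : ∀ i, p * e i = e i

theorem IsPacking.isStarProjection_sum {n : ℕ} {g p : A} {e : Fin n → A} (h : IsPacking g p e) :
    IsStarProjection (∑ i, e i) :=
  ContLogic.isStarProjection_sum _ (fun i _ => h.proj i) fun i _ j _ => h.orth i j

theorem IsPacking.mul_sum {n : ℕ} {g p : A} {e : Fin n → A} (h : IsPacking g p e) :
    p * ∑ i, e i = ∑ i, e i := by
  rw [Finset.mul_sum]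
  exact Finset.sum_congr rfl fun i _ => h.le i

theorem IsPacking.isStarProjection_sub {n : ℕ} {g p : A} {e : Fin n → A} (h : IsPacking g p e)
    (hp : IsStarProjection p) : IsStarProjection (p - ∑ i, e i) :=
  h.isStarProjection_sum.sub_of_mul_eq_right hp h.mul_sum

theorem IsPacking.hasOrthogonalCopies {n : ℕ} {g p : A} {e : Fin n → A} (h : IsPacking g p e) :
    HasOrthogonalCopies n g := ⟨e, h.proj, h.orth, h.equiv⟩

theorem IsPacking.cons {n : ℕ} {g p : A} {e : Fin n → A} (h : IsPacking g p e)
    (hp : IsStarProjection p) {r : A} (hr : IsStarProjection r) (hg : MvNEquiv g r)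
    (hle : (p - ∑ i, e i) * r = r) : IsPacking g p (Fin.cons r e : Fin (n + 1) → A) := by
  have hS := h.isStarProjection_sum
  have hSr : (∑ i, e i) * r = 0 := by
    rw [← hle, ← mul_assoc, mul_sub, hS.isIdempotentElem.eq,
      IsStarProjection.mul_comm_of_mul_eq hp hS h.mul_sum, sub_self, zero_mul]
  have her : ∀ i, e i * r = 0 := fun i => by
    have : e i * ∑ j, e j = e i := by
      rw [Finset.mul_sum, Finset.sum_eq_single i (fun j _ hj => h.orth i j hj.symm) (by simp),
        (h.proj i).isIdempotentElem.eq]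
    rw [← this, mul_assoc, hSr, mul_zero]
  refine ⟨fun i => ?_, fun i j => ?_, fun i => ?_, fun i => ?_⟩
  · refine Fin.cases ?_ (fun i => ?_) i
    · exact hr
    · exact h.proj i
  · refine Fin.cases ?_ (fun i => ?_) i <;> refine Fin.cases ?_ (fun j => ?_) j
    · simp
    · intro _
      exact IsStarProjection.mul_eq_zero_comm (h.proj j) hr (her j)
    · intro _
      exact her i
    · intro hij
      exact h.orth i j fun hh => hij (by rw [hh])
  · refine Fin.cases ?_ (fun i => ?_) i
    · exact hg
    · exact h.equiv i
  · refine Fin.cases ?_ (fun i => ?_) i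
    · rw [Fin.cons_zero, ← hle, ← mul_assoc, mul_sub, hp.isIdempotentElem.eq, h.mul_sum]
    · exact h.le i

/-- Either `n` orthogonal copies of `g` fit below `p`, or fewer of them exhaust `p` up to a
remainder that is subequivalent to `g`. -/
theorem IsPseudomatricial.exists_packing (hA : IsPseudomatricial A) {g p : A}
    (hg : IsStarProjection g) (hp : IsStarProjection p) (n : ℕ) :
    (∃ e : Fin n → A, IsPacking g p e) ∨
      ∃ j < n, ∃ e : Fin j → A, IsPacking g p e ∧ MvNLE (p - ∑ i, e i) g := by
  induction n with
  | zero => exact .inl ⟨Fin.elim0, fun i => i.elim0, fun i => i.elim0, fun i => i.elim0,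
      fun i => i.elim0⟩
  | succ n ih =>
    rcases ih with ⟨e, he⟩ | ⟨j, hj, e, he⟩
    · rcases hA.mvnLE_or_mvnLE hg (he.isStarProjection_sub hp) with h | h
      · obtain ⟨r, hr, hgr, hle⟩ := h.exists_equiv hg
        exact .inl ⟨_, he.cons hp hr hgr hle⟩
      · exact .inr ⟨n, Nat.lt_succ_self n, e, he, h⟩
    · exact .inr ⟨j, Nat.lt_succ_of_lt hj, e, he⟩

/-- If $w_i$ carries $q$ to its $i$-th copy and $v$ embeds $r$ in $q$, then $w_iv$ cuts a copy of
$r$ out of that copy. -/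
theorem HasOrthogonalCopies.of_mvnLE {n : ℕ} {r q : A} (hr : IsStarProjection r)
    (hq : IsStarProjection q) (h : HasOrthogonalCopies n q) (hle : MvNLE r q) :
    HasOrthogonalCopies n r := by
  obtain ⟨e, he, ho, heq⟩ := h
  choose w hw1 hw2 using heq
  obtain ⟨s, hs, hrs, hqs⟩ := hle.exists_equiv hr
  obtain ⟨v, rfl, rfl⟩ := hrs
  have hqv : q * v = v := by
    conv_rhs => rw [← mul_star_mul_self hr, ← mul_assoc, ← hqs]
    rw [mul_assoc, mul_assoc v, mul_star_mul_self hr]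
  have h1 : ∀ i, star (w i * v) * (w i * v) = star v * v := fun i => by
    rw [star_mul, mul_assoc, ← mul_assoc (star (w i)), hw1, hqv]
  have h2 : ∀ i, e i * w i = w i := fun i => by
    rw [← hw2, mul_assoc, mul_star_mul_self (by rw [hw1]; exact hq)]
  refine ⟨fun i => w i * v * star (w i * v), fun i => isStarProjection_mul_star (by rwa [h1]),
    fun i j hij => ?_, fun i => ⟨_, h1 i, rfl⟩⟩
  have h3 : star (w i) * w j = 0 := by
    have h4 := congrArg star (h2 i)
    rw [star_mul, (he i).isSelfAdjoint.star_eq] at h4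
    rw [← h2 j, ← h4, mul_assoc, ← mul_assoc (e i), ho i j hij, zero_mul, mul_zero]
  rw [mul_star_mul_mul_star, star_mul, mul_assoc (star v), ← mul_assoc (star (w i)), h3, zero_mul,
    mul_zero, mul_zero, zero_mul]

theorem IsMinimalProjection.equiv_or_eq_zero {f r : A} (hf : IsMinimalProjection f)
    (hr : IsStarProjection r) (h : MvNLE r f) : r = 0 ∨ MvNEquiv f r := by
  obtain ⟨s, hs, hrs, hfs⟩ := h.exists_equiv hr
  rcases hf.2.2 s hs hfs with rfl | rfl
  · exact .inl hrs.eq_zero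
  · exact .inr hrs.symm

theorem IsPseudomatricial.equiv_of_isMinimalProjection (hA : IsPseudomatricial A) {f g : A}
    (hf : IsMinimalProjection f) (hg : IsMinimalProjection g) : MvNEquiv f g := by
  rcases hA.mvnLE_or_mvnLE hf.1 hg.1 with h | h
  · exact (hg.equiv_or_eq_zero hf.1 h).elim (fun h => absurd h hf.2.1) MvNEquiv.symm
  · exact (hf.equiv_or_eq_zero hg.1 h).elim (fun h => absurd h hg.2.1) id

/-- A proper nonzero subprojection $q$ would be near some $cf$. Multiplying by $q$ and by $f-q$
gives $|1-c|\le1/4$ and $|c|\le1/4$, which is impossible. -/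
theorem isMinimalProjection_of_corner_near {f : A} (hf : IsStarProjection f) (hf0 : f ≠ 0)
    (h : ∀ x : A, ‖x‖ ≤ 1 → ∃ c : ℂ, ‖f * x * f - c • f‖ ≤ 1 / 4) : IsMinimalProjection f := by
  refine ⟨hf, hf0, fun q hq hfq => ?_⟩
  by_contra! hne
  obtain ⟨c, hc⟩ := h q hq.norm_le
  have hqf := IsStarProjection.mul_comm_of_mul_eq hf hq hfq
  rw [hfq, hqf] at hc
  have hr := hq.sub_of_mul_eq_right hf hfq
  have h1 : ‖(1 - c) • q‖ ≤ 1 / 4 := by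
    have e : (1 - c) • q = q * (q - c • f) := by
      rw [mul_sub, mul_smul_comm, hq.isIdempotentElem.eq, hqf, sub_smul, one_smul]
    rw [e]
    exact (norm_mul_le _ _).trans ((mul_le_of_le_one_left (norm_nonneg _) hq.norm_le).trans hc)
  have h2 : ‖c • (f - q)‖ ≤ 1 / 4 := by
    have e : -(c • (f - q)) = (f - q) * (q - c • f) := by
      rw [mul_sub, mul_smul_comm, sub_mul, hfq, hq.isIdempotentElem.eq, sub_self, sub_mul,
        hf.isIdempotentElem.eq, hqf, zero_sub]
    rw [← norm_neg, e]
    exact (norm_mul_le _ _).trans ((mul_le_of_le_one_left (norm_nonneg _) hr.norm_le).trans hc)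
  rw [norm_smul, IsStarProjection.norm_eq_one hq hne.1, mul_one] at h1
  rw [norm_smul, IsStarProjection.norm_eq_one hr (sub_ne_zero.mpr hne.2.symm), mul_one] at h2
  have h3 := norm_add_le (1 - c) c
  rw [sub_add_cancel, norm_one] at h3
  linarith

/-- There is a minimal projection, and it has a one-dimensional corner. -/
theorem IsPseudomatricial.exists_isMinimalProjection (hA : IsPseudomatricial A) :
    ∃ f : A, IsMinimalProjection f ∧ ∀ x : A, ∃ c : ℂ, f * x * f = c • f := by
  have hmin : ∀ {η : ℝ}, η ≤ 1 / 12 → ∀ {f : A}, IsStarProjection f → f ≠ 0 →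
      (∀ x : A, ‖x‖ ≤ 1 → ∃ c : ℂ, ‖f * x * f - c • f‖ ≤ 3 * η) → IsMinimalProjection f :=
    fun {η} hη {f} hf hf0 h => isMinimalProjection_of_corner_near hf hf0 fun x hx => by
      obtain ⟨c, hc⟩ := h x hx
      exact ⟨c, hc.trans (by linarith)⟩
  obtain ⟨f, hf, hf0, hfx⟩ := hA.exists_corner_near (η := 1 / 12) (by norm_num)
  have hfm := hmin le_rfl hf hf0 hfx
  refine ⟨f, hfm, fun x => ?_⟩
  -- Each $\varepsilon$ provides its own projection $g$ with an almost scalar corner. Both $f$ and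
  -- $g$ are minimal, hence equivalent, so the estimate moves to the fixed $f$; closedness of
  -- $\mathbb Cf$ makes it exact.
  have key : ∀ y : A, ‖y‖ ≤ 1 → f * y * f ∈ Submodule.span ℂ {f} := fun y hy => by
    have hcl : IsClosed (Submodule.span ℂ {f} : Set A) := Submodule.closed_of_finiteDimensional _
    rw [← SetLike.mem_coe, ← hcl.closure_eq, Metric.mem_closure_iff]
    intro ε hε
    obtain ⟨η, hη, hη1, hη2⟩ : ∃ η > 0, η ≤ 1 / 12 ∧ 3 * η < ε :=
      ⟨min (1 / 12) (ε / 4), lt_min (by norm_num) (by positivity), min_le_left _ _, by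
        have := min_le_right (1 / 12) (ε / 4)
        linarith⟩
    obtain ⟨g, hg, hg0, hgx⟩ := hA.exists_corner_near hη
    obtain ⟨u, hu1, hu2⟩ := hA.equiv_of_isMinimalProjection hfm (hmin hη1 hg hg0 hgx)
    have hu : IsStarProjection (star u * u) := hu1 ▸ hf
    have hun := norm_le_one_of_star_mul_self hu
    have huf : u * f = u := hu1 ▸ mul_star_mul_self hu
    have hgu : g * u = u := by rw [← hu2, mul_assoc, mul_star_mul_self hu]
    have huf' : f * star u = star u := by
      have := congrArg star huf
      rwa [star_mul, hf.isSelfAdjoint.star_eq] at this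
    have hgu' : star u * g = star u := by
      have := congrArg star hgu
      rwa [star_mul, hg.isSelfAdjoint.star_eq] at this
    have hus : ‖star u‖ ≤ 1 := by rwa [norm_star]
    obtain ⟨c, hc⟩ := hgx (u * y * star u) ((norm_mul_le _ _).trans (mul_le_one₀
      ((norm_mul_le _ _).trans (mul_le_one₀ hun (norm_nonneg _) hy)) (norm_nonneg _) hus))
    refine ⟨c • f, Submodule.smul_mem _ _ (Submodule.mem_span_singleton_self f), ?_⟩
    rw [dist_eq_norm]
    have e : f * y * f - c • f = star u * (g * (u * y * star u) * g - c • g) * u := by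
      rw [mul_sub, sub_mul, mul_smul_comm, smul_mul_assoc, hgu', hu1]
      congr 1
      calc f * y * f = star u * u * y * (star u * u) := by rw [hu1]
        _ = (star u * g) * (u * y * star u) * (g * u) := by
            rw [hgu', hgu]
            simp only [mul_assoc]
        _ = _ := by simp only [mul_assoc]
    rw [e]
    refine lt_of_le_of_lt ((norm_mul_le _ _).trans (mul_le_of_le_one_right (norm_nonneg _) hun))
      (lt_of_le_of_lt ((norm_mul_le _ _).trans (mul_le_of_le_one_left (norm_nonneg _) hus)) ?_)
    linarith
  have hx : f * x * f ∈ Submodule.span ℂ {f} := by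
    by_cases h0 : x = 0
    · simp [h0]
    · have hn : (‖x‖ : ℂ) ≠ 0 := by simpa using h0
      have h1 := key ((‖x‖ : ℂ)⁻¹ • x) (by
        rw [norm_smul, norm_inv, Complex.norm_real, norm_norm,
          inv_mul_cancel₀ (norm_ne_zero_iff.mpr h0)])
      have h2 := Submodule.smul_mem _ (‖x‖ : ℂ) h1
      rwa [mul_smul_comm, smul_mul_assoc, smul_smul, mul_inv_cancel₀ hn, one_smul] at h2
  obtain ⟨c, hc⟩ := Submodule.mem_span_singleton.mp hx
  exact ⟨c, hc.symm⟩

/-- Approximating the normalised error by $q-\frac12q'$ shrinks it by the factor $3/4$ and keeps it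
self-adjoint, so the step repeats. -/
theorem IsPseudomatricial.exists_span_near (hA : IsPseudomatricial A) (n : ℕ) :
    ∀ x : A, IsSelfAdjoint x → ∃ w ∈ Submodule.span ℂ {p : A | IsStarProjection p},
      IsSelfAdjoint w ∧ ‖x - w‖ ≤ (3 / 4) ^ n * ‖x‖ := by
  induction n with
  | zero => exact fun x _ => ⟨0, Submodule.zero_mem _, .zero _, by simp⟩
  | succ n ih =>
    intro x hx
    obtain ⟨w, hw, hws, hle⟩ := ih x hx
    set z := x - w with hz
    have hzs : IsSelfAdjoint z := hx.sub hws
    by_cases hz0 : z = 0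
    · refine ⟨w, hw, hws, ?_⟩
      rw [← hz, hz0, norm_zero]
      positivity
    have hn : ‖z‖ ≠ 0 := norm_ne_zero_iff.mpr hz0
    have hnC : (‖z‖ : ℂ) ≠ 0 := by exact_mod_cast hn
    have hreal : ∀ r : ℝ, IsSelfAdjoint (r : ℂ) := fun r => Complex.conj_ofReal r
    have hys : IsSelfAdjoint ((((‖z‖)⁻¹ : ℝ) : ℂ) • z) := (hreal _).smul hzs
    obtain ⟨q, q', hq, hq', hqn⟩ := hA.exists_projections_near hys (by
      rw [norm_smul, Complex.norm_real, norm_inv, norm_norm, inv_mul_cancel₀ hn])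
    have hhalf : IsSelfAdjoint (1 / 2 : ℂ) := by
      have := hreal (1 / 2)
      push_cast at this
      exact this
    refine ⟨w + (‖z‖ : ℂ) • (q - (1 / 2 : ℂ) • q'), ?_, ?_, ?_⟩
    · exact Submodule.add_mem _ hw (Submodule.smul_mem _ _ (Submodule.sub_mem _
        (Submodule.subset_span hq) (Submodule.smul_mem _ _ (Submodule.subset_span hq'))))
    · exact hws.add ((hreal _).smul (hq.isSelfAdjoint.sub (hhalf.smul hq'.isSelfAdjoint)))
    · have e : x - (w + (‖z‖ : ℂ) • (q - (1 / 2 : ℂ) • q')) =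
          (‖z‖ : ℂ) • ((((‖z‖)⁻¹ : ℝ) : ℂ) • z - q + (1 / 2 : ℂ) • q') := by
        rw [smul_add, smul_sub, smul_sub, Complex.ofReal_inv, smul_inv_smul₀ hnC, hz]
        abel
      rw [e, norm_smul, Complex.norm_real, norm_norm, pow_succ]
      have : ‖z‖ * (3 / 4) ≤ (3 / 4) ^ n * ‖x‖ * (3 / 4) := by gcongr
      refine (mul_le_mul_of_nonneg_left hqn (norm_nonneg _)).trans (this.trans (le_of_eq ?_))
      ring

theorem IsPseudomatricial.closure_span_projections (hA : IsPseudomatricial A) :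
    closure (Submodule.span ℂ {p : A | IsStarProjection p} : Set A) = Set.univ := by
  have hsa : ∀ x : A, IsSelfAdjoint x →
      x ∈ (Submodule.span ℂ {p : A | IsStarProjection p}).topologicalClosure := fun x hx => by
    rw [← SetLike.mem_coe, Submodule.topologicalClosure_coe, Metric.mem_closure_iff]
    intro ε hε
    have hlim : Filter.Tendsto (fun n : ℕ => (3 / 4 : ℝ) ^ n * ‖x‖) Filter.atTop (nhds 0) := by
      simpa using (tendsto_pow_atTop_nhds_zero_of_lt_one (by norm_num)
        (by norm_num : (3 / 4 : ℝ) < 1)).mul_const ‖x‖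
    obtain ⟨n, hn⟩ := (hlim.eventually (gt_mem_nhds hε)).exists
    obtain ⟨w, hw, -, hle⟩ := hA.exists_span_near n x hx
    exact ⟨w, hw, by rw [dist_eq_norm]; exact hle.trans_lt hn⟩
  refine Set.eq_univ_of_forall fun x => ?_
  rw [← Submodule.topologicalClosure_coe, SetLike.mem_coe,
    ← realPart_add_I_smul_imaginaryPart x]
  exact Submodule.add_mem _ (hsa _ (realPart x).2) (Submodule.smul_mem _ _
    (hsa _ (imaginaryPart x).2))

end Packings

/-! ### The trace as the quotient by commutators, and traces of projections. -/

section Trace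

variable {A : Type*} [CStarAlgebra A]

variable (A) in
/-- The closed linear span of the commutators. -/
noncomputable def commutators : Submodule ℂ A :=
  (Submodule.span ℂ (Set.range fun x : A × A => x.1 * x.2 - x.2 * x.1)).topologicalClosure

theorem commutator_mem (a b : A) : a * b - b * a ∈ commutators A :=
  Submodule.le_topologicalClosure _ (Submodule.subset_span ⟨(a, b), rfl⟩)

theorem isClosed_commutators : IsClosed (commutators A : Set A) :=
  Submodule.isClosed_topologicalClosure _

theorem commutators_le {V : Submodule ℂ A} (hV : IsClosed (V : Set A))
    (h : ∀ a b : A, a * b - b * a ∈ V) : commutators A ≤ V :=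
  Submodule.topologicalClosure_minimal _
    (Submodule.span_le.mpr (by rintro _ ⟨x, rfl⟩; exact h _ _)) hV

theorem star_mem_commutators {x : A} (hx : x ∈ commutators A) : star x ∈ commutators A := by
  let V : Submodule ℂ A :=
    { carrier := {x | star x ∈ commutators A}
      add_mem' := fun {a b} ha hb => by
        simpa using Submodule.add_mem _ (Set.mem_ofPred_eq ▸ ha) (Set.mem_ofPred_eq ▸ hb)
      zero_mem' := by simp
      smul_mem' := fun c a ha => by
        simpa [star_smul] using Submodule.smul_mem _ (star c) (Set.mem_ofPred_eq ▸ ha) }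
  refine commutators_le (V := V) (isClosed_commutators.preimage continuous_star)
    (fun a b => ?_) hx
  change star (a * b - b * a) ∈ commutators A
  rw [star_sub, star_mul, star_mul]
  exact commutator_mem _ _

theorem MvNEquiv.sub_mem_commutators {p q : A} (h : MvNEquiv p q) : p - q ∈ commutators A := by
  obtain ⟨v, rfl, rfl⟩ := h
  exact commutator_mem _ _

/-- A finite linear combination of commutators is a multiple of a sum of commutators of
contractions. -/
theorem exists_sum_commutators {c : A}
    (hc : c ∈ Submodule.span ℂ (Set.range fun x : A × A => x.1 * x.2 - x.2 * x.1)) :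
    ∃ (k : ℕ) (a b : Fin k → A), c = ∑ i, (a i * b i - b i * a i) := by
  induction hc using Submodule.span_induction with
  | mem x hx =>
    obtain ⟨y, rfl⟩ := hx
    exact ⟨1, fun _ => y.1, fun _ => y.2, by simp⟩
  | zero => exact ⟨0, Fin.elim0, Fin.elim0, by simp⟩
  | add x y _ _ hx hy =>
    obtain ⟨k, a, b, rfl⟩ := hx
    obtain ⟨l, a', b', rfl⟩ := hy
    exact ⟨k + l, Fin.append a a', Fin.append b b', by
      simp [Fin.sum_univ_add]
      abel⟩
  | smul r x _ hx =>
    obtain ⟨k, a, b, rfl⟩ := hx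
    refine ⟨k, fun i => r • a i, b, ?_⟩
    rw [Finset.smul_sum]
    exact Finset.sum_congr rfl fun i _ => by
      rw [smul_sub, smul_mul_assoc, mul_smul_comm]

theorem exists_scaled_commutators {k : ℕ} (a b : Fin k → A) :
    ∃ (M : ℂ) (a' b' : Fin k → A), (∀ i, ‖a' i‖ ≤ 1) ∧ (∀ i, ‖b' i‖ ≤ 1) ∧
      ∑ i, (a i * b i - b i * a i) = M • ∑ i, (a' i * b' i - b' i * a' i) := by
  let R : ℝ := 1 + ∑ i, (‖a i‖ + ‖b i‖)
  have hs : ∀ i, ‖a i‖ + ‖b i‖ ≤ ∑ i, (‖a i‖ + ‖b i‖) := fun i =>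
    Finset.single_le_sum (f := fun i => ‖a i‖ + ‖b i‖) (fun i _ => by positivity)
      (Finset.mem_univ i)
  have hR0 : 0 < R := by
    have : 0 ≤ ∑ i, (‖a i‖ + ‖b i‖) := Finset.sum_nonneg fun i _ => by positivity
    simp only [R]
    linarith
  have hRC : (R : ℂ) ≠ 0 := by exact_mod_cast hR0.ne'
  have hn : ∀ x : A, ‖x‖ ≤ R → ‖(R : ℂ)⁻¹ • x‖ ≤ 1 := fun x hx => by
    rw [norm_smul, norm_inv, Complex.norm_real, Real.norm_of_nonneg hR0.le]
    exact inv_mul_le_one_of_le₀ hx hR0.le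
  refine ⟨(R : ℂ) * R, fun i => (R : ℂ)⁻¹ • a i, fun i => (R : ℂ)⁻¹ • b i,
    fun i => hn _ ?_, fun i => hn _ ?_, ?_⟩
  · have := hs i
    have := norm_nonneg (b i)
    simp only [R]
    linarith
  · have := hs i
    have := norm_nonneg (a i)
    simp only [R]
    linarith
  · rw [Finset.smul_sum]
    refine Finset.sum_congr rfl fun i _ => ?_
    simp only [smul_mul_assoc, mul_smul_comm, ← smul_sub, smul_smul]
    rw [show (R : ℂ) * R * ((R : ℂ)⁻¹ * (R : ℂ)⁻¹) = 1 by field_simp, one_smul]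

/-- The condition is closed, so finite sums of commutators suffice. They are rescaled to commutators
of contractions because transfer sees only the unit ball. -/
theorem IsPseudomatricial.one_le_norm_one_sub (hA : IsPseudomatricial A)
    {c : A} (hc : c ∈ commutators A) :
    1 ≤ ‖1 - c‖ := by
  have hcl : IsClosed {c : A | 1 ≤ ‖1 - c‖} := isClosed_le continuous_const (by fun_prop)
  refine closure_minimal (fun c hc => ?_) hcl hc
  obtain ⟨k, a, b, rfl⟩ := exists_sum_commutators hc
  obtain ⟨M, a', b', ha, hb, he⟩ := exists_scaled_commutators a b
  rw [Set.mem_ofPred_eq, he]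
  refine le_of_forall_pos_lt_add fun ε hε => ?_
  obtain ⟨y, hy, hlt⟩ := hA.exists_one_sub_lt_norm M a' b' ha hb hε
  have e : y - (M • ∑ i, (a' i * b' i - b' i * a' i)) * y =
      (1 - M • ∑ i, (a' i * b' i - b' i * a' i)) * y := by rw [sub_mul, one_mul]
  rw [e] at hlt
  have := (norm_mul_le (1 - M • ∑ i, (a' i * b' i - b' i * a' i)) y).trans
    (mul_le_of_le_one_right (norm_nonneg _) hy)
  linarith

/-- Dividing by $-c$ turns this into the distance bound for the unit. It gives contractivity of the
trace and uniqueness of the scalar. -/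
theorem IsPseudomatricial.norm_le_of_sub_mem (hA : IsPseudomatricial A)
    {x : A} {c : ℂ} (h : x - c • 1 ∈ commutators A) :
    ‖c‖ ≤ ‖x‖ := by
  by_cases hc : c = 0
  · simp [hc]
  · have h1 := hA.one_le_norm_one_sub (Submodule.smul_mem _ (-c⁻¹) h)
    have e : (1 : A) - -c⁻¹ • (x - c • 1) = c⁻¹ • x := by
      rw [neg_smul, sub_neg_eq_add, smul_sub, smul_smul, inv_mul_cancel₀ hc, one_smul]
      abel
    rw [e, norm_smul, norm_inv, inv_mul_eq_div, le_div_iff₀ (norm_pos_iff.mpr hc), one_mul] at h1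
    exact h1

theorem IsPseudomatricial.eq_of_sub_mem (hA : IsPseudomatricial A)
    {x : A} {c d : ℂ} (hc : x - c • 1 ∈ commutators A)
    (hd : x - d • 1 ∈ commutators A) : c = d := by
  have h := Submodule.sub_mem _ hd hc
  have e : x - d • 1 - (x - c • 1) = (0 : A) - (d - c) • 1 := by
    rw [sub_smul]
    abel
  rw [e] at h
  have := hA.norm_le_of_sub_mem h
  rw [norm_zero, norm_le_zero_iff, sub_eq_zero] at this
  exact this.symm

theorem IsPacking.smul_sub_sum_mem {n : ℕ} {g p : A} {e : Fin n → A} (h : IsPacking g p e) :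
    (n : ℂ) • g - ∑ i, e i ∈ commutators A := by
  have e1 : (n : ℂ) • g - ∑ i, e i = ∑ i, (g - e i) := by
    rw [Finset.sum_sub_distrib, Finset.sum_const, Finset.card_univ, Fintype.card_fin,
      Nat.cast_smul_eq_nsmul]
  rw [e1]
  exact Submodule.sum_mem _ fun i _ => (h.equiv i).sub_mem_commutators

theorem HasOrthogonalCopies.exists_isPacking {n : ℕ} {g : A} (h : HasOrthogonalCopies n g) :
    ∃ e : Fin n → A, IsPacking g 1 e := by
  obtain ⟨e, h1, h2, h3⟩ := h
  exact ⟨e, h1, h2, h3, fun i => one_mul _⟩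

/-- Modulo commutators, $ng$ equals the sum of the copies, a projection of norm at most $1$. -/
theorem HasOrthogonalCopies.exists_mem_norm_sub_le {n : ℕ} {g : A} (h : HasOrthogonalCopies n g)
    (hn : 1 ≤ n) : ∃ k ∈ commutators A, ‖g - k‖ ≤ 1 / n := by
  obtain ⟨e, he⟩ := h.exists_isPacking
  have hn0 : (n : ℂ) ≠ 0 := by exact_mod_cast (by omega : n ≠ 0)
  refine ⟨_, Submodule.smul_mem _ (n : ℂ)⁻¹ he.smul_sub_sum_mem, ?_⟩
  rw [smul_sub, inv_smul_smul₀ hn0, sub_sub_cancel, norm_smul, norm_inv, Complex.norm_natCast,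
    one_div]
  exact mul_le_of_le_one_right (by positivity) he.isStarProjection_sum.norm_le

theorem mem_commutators_of_forall_copies {f : A} (h : ∀ n, HasOrthogonalCopies n f) :
    f ∈ commutators A := by
  rw [← SetLike.mem_coe, ← isClosed_commutators.closure_eq, Metric.mem_closure_iff]
  intro ε hε
  obtain ⟨n, hn⟩ := exists_nat_one_div_lt hε
  obtain ⟨k, hk, hle⟩ := (h (n + 1)).exists_mem_norm_sub_le (by omega)
  refine ⟨k, hk, ?_⟩
  rw [dist_eq_norm]
  push_cast at hle
  linarith

/-- If a minimal projection has only finitely many orthogonal copies, then finitely many copies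
of it sum up to the unit. -/
theorem IsPseudomatricial.exists_packing_eq_one (hA : IsPseudomatricial A)
    {f : A} (hf : IsMinimalProjection f)
    (h : ¬ ∀ n, HasOrthogonalCopies n f) :
    ∃ (N : ℕ) (e : Fin N → A), IsPacking f 1 e ∧ ∑ i, e i = 1 := by
  push Not at h
  obtain ⟨n, hn⟩ := h
  rcases hA.exists_packing hf.1 (.one A) n with ⟨e, he⟩ | ⟨j, hj, e, he, hle⟩
  · exact absurd he.hasOrthogonalCopies hn
  · have hr := he.isStarProjection_sub (.one A)
    rcases hf.equiv_or_eq_zero hr hle with h0 | h0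
    · exact ⟨j, e, he, (sub_eq_zero.mp h0).symm⟩
    · refine ⟨j + 1, _, he.cons (.one A) hr h0 hr.isIdempotentElem.eq, ?_⟩
      rw [Fin.sum_univ_succ]
      simp

theorem IsPseudomatricial.nontrivial (hA : IsPseudomatricial A) : Nontrivial A := by
  obtain ⟨f, hf, -⟩ := hA.exists_isMinimalProjection
  exact nontrivial_of_ne f 0 hf.2.1

/-- Every projection is a multiple of a projection of trace `1 / n` up to a remainder. -/
theorem IsPseudomatricial.exists_multiple (hA : IsPseudomatricial A) {n : ℕ} (hn : 1 ≤ n) {g p : A}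
    (hg : IsStarProjection g) (hgn : (n : ℂ) • g - 1 ∈ commutators A)
    (hp : IsStarProjection p) : ∃ (j : ℕ) (e : Fin j → A), IsPacking g p e ∧
      MvNLE (p - ∑ i, e i) g := by
  -- A projection made of $n+1$ copies of $g$ would be congruent to $(n+1)/n>1$ modulo commutators,
  -- exceeding its norm.
  rcases hA.exists_packing hg hp (n + 1) with ⟨e, he⟩ | ⟨j, -, e, he, hle⟩
  · exfalso
    have hn0 : (n : ℂ) ≠ 0 := by exact_mod_cast (by omega : n ≠ 0)
    have h1 : ∑ i, e i - (((n + 1 : ℕ) : ℂ) * (n : ℂ)⁻¹) • 1 ∈ commutators A := by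
      have h2 := Submodule.sub_mem _ (Submodule.smul_mem _ (((n + 1 : ℕ) : ℂ) * (n : ℂ)⁻¹) hgn)
        he.smul_sub_sum_mem
      rw [smul_sub, smul_smul, inv_mul_cancel_right₀ hn0] at h2
      convert h2 using 1
      abel
    have h3 := (hA.norm_le_of_sub_mem h1).trans he.isStarProjection_sum.norm_le
    rw [norm_mul, norm_inv, Complex.norm_natCast, Complex.norm_natCast] at h3
    have h4 : (0 : ℝ) < n := by exact_mod_cast hn
    rw [← div_eq_mul_inv, div_le_one h4] at h3
    push_cast at h3
    linarith
  · exact ⟨j, e, he, hle⟩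

/-- The remainders of an approximate $n$-th of $1$ are minimal, hence equivalent to $f$, and so
vanish modulo commutators. -/
theorem IsPseudomatricial.approxFraction_one (hA : IsPseudomatricial A)
    {f : A} (hf : IsMinimalProjection f)
    (h : ∀ n, HasOrthogonalCopies n f) {n : ℕ} (hn : 1 ≤ n) :
    ∃ q : A, IsStarProjection q ∧ HasOrthogonalCopies n q ∧
      (n : ℂ) • q - 1 ∈ commutators A := by
  obtain ⟨q, k, e, m, hk, he, hm, heo, hmo, hem, hqe, ⟨i₀, hi₀⟩, hsum⟩ :=
    hA.exists_isApproxFraction (.one A) hf hn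
  have hpack : IsPacking q 1 e := ⟨he, heo, hqe, fun i => one_mul _⟩
  refine ⟨q, hi₀ ▸ he i₀, hpack.hasOrthogonalCopies, ?_⟩
  have hm0 : ∑ j, m j ∈ commutators A := Submodule.sum_mem _ fun j _ => by
    have h1 := (hA.equiv_of_isMinimalProjection hf (hm j)).sub_mem_commutators
    have h2 := Submodule.sub_mem _ (mem_commutators_of_forall_copies h) h1
    rwa [sub_sub_cancel] at h2
  have h3 := Submodule.sub_mem _ hpack.smul_sub_sum_mem hm0
  rwa [sub_sub, ← hsum] at h3

/-- Every element is a scalar modulo the closed span of the commutators. -/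
theorem IsPseudomatricial.exists_sub_mem (hA : IsPseudomatricial A)
    (x : A) : ∃ c : ℂ, x - c • 1 ∈ commutators A := by
  let M : Submodule ℂ A := commutators A ⊔ Submodule.span ℂ {1}
  -- As $M$ is closed and the span of the projections is dense, only projections need to be placed
  -- in $M$.
  have hM : IsClosed (M : Set A) := Submodule.isClosed_sup_finiteDimensional _ _
    isClosed_commutators
  have h1 : (1 : A) ∈ M := Submodule.mem_sup_right (Submodule.mem_span_singleton_self 1)
  have hK : ∀ {y : A}, y ∈ commutators A → y ∈ M := fun h => Submodule.mem_sup_left h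
  have hg : ∀ {n : ℕ} {g : A}, 1 ≤ n → (n : ℂ) • g - 1 ∈ commutators A → g ∈ M := by
    intro n g hn h
    have hn0 : (n : ℂ) ≠ 0 := by exact_mod_cast (by omega : n ≠ 0)
    have h2 := Submodule.smul_mem M (n : ℂ)⁻¹ (Submodule.add_mem M (hK h) h1)
    rwa [sub_add_cancel, inv_smul_smul₀ hn0] at h2
  have hpk : ∀ {j : ℕ} {g p : A} {e : Fin j → A}, IsPacking g p e → g ∈ M → ∑ i, e i ∈ M := by
    intro j g p e he hgM
    have := Submodule.sub_mem M (Submodule.smul_mem M (j : ℂ) hgM) (hK he.smul_sub_sum_mem)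
    rwa [sub_sub_cancel] at this
  obtain ⟨f, hf, -⟩ := hA.exists_isMinimalProjection
  have hproj : ∀ p : A, IsStarProjection p → p ∈ M := by
    intro p hp
    by_cases hinf : ∀ n, HasOrthogonalCopies n f
    · rw [← SetLike.mem_coe, ← hM.closure_eq, Metric.mem_closure_iff]
      intro ε hε
      obtain ⟨n, hn⟩ := exists_nat_one_div_lt hε
      obtain ⟨q, hq, hqc, hq1⟩ := hA.approxFraction_one hf hinf (n := n + 1) (by omega)
      obtain ⟨j, e, he, hle⟩ := hA.exists_multiple (by omega) hq hq1 hp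
      -- The remainder is subequivalent to $q$, so it also has $n+1$ orthogonal copies and is within
      -- $1/(n+1)$ of the commutators.
      obtain ⟨k, hk, hkle⟩ := (hqc.of_mvnLE (he.isStarProjection_sub hp) hq
        hle).exists_mem_norm_sub_le (by omega)
      refine ⟨∑ i, e i + k, Submodule.add_mem M (hpk he (hg (by omega) hq1)) (hK hk), ?_⟩
      rw [dist_eq_norm, ← sub_sub]
      push_cast at hkle
      linarith
    · obtain ⟨N, e, he, hsum⟩ := hA.exists_packing_eq_one hf hinf
      have := hA.nontrivial
      have hN : 1 ≤ N := by
        rcases Nat.eq_zero_or_pos N with rfl | h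
        · simp at hsum
        · exact h
      have hf1 : (N : ℂ) • f - 1 ∈ commutators A := hsum ▸ he.smul_sub_sum_mem
      obtain ⟨j, e', he', hle⟩ := hA.exists_multiple hN hf.1 hf1 hp
      have hr : p - ∑ i, e' i ∈ M := by
        rcases hf.equiv_or_eq_zero (he'.isStarProjection_sub hp) hle with h | h
        · rw [h]
          exact Submodule.zero_mem M
        · have := Submodule.sub_mem M (hg hN hf1) (hK h.sub_mem_commutators)
          rwa [sub_sub_cancel] at this
      have := Submodule.add_mem M hr (hpk he' (hg hN hf1))
      rwa [sub_add_cancel] at this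
  have hx : x ∈ M := by
    have h2 : x ∈ closure (Submodule.span ℂ {p : A | IsStarProjection p} : Set A) := by
      rw [hA.closure_span_projections]
      trivial
    exact closure_minimal (Submodule.span_le.mpr hproj) hM h2
  obtain ⟨k, hk, s, hs, rfl⟩ := Submodule.mem_sup.mp hx
  obtain ⟨c, rfl⟩ := Submodule.mem_span_singleton.mp hs
  exact ⟨c, by rwa [add_sub_cancel_right]⟩

theorem norm_one_sub_star_mul_self_le {a : A} (ha : ‖a‖ ≤ 1) : ‖1 - star a * a‖ ≤ 1 := by
  let _ := CStarAlgebra.spectralOrder A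
  have := CStarAlgebra.spectralOrderedRing A
  have h0 : 0 ≤ star a * a := star_mul_self_nonneg a
  have h1 : star a * a ≤ 1 := by
    rw [← CStarAlgebra.norm_le_one_iff_of_nonneg _ h0, CStarRing.norm_star_mul_self]
    exact mul_le_one₀ ha (norm_nonneg _) ha
  rw [CStarAlgebra.norm_le_one_iff_of_nonneg _ (sub_nonneg.mpr h1)]
  exact sub_le_self _ h0

open scoped ComplexOrder

theorem IsTracialState.apply_eq_zero {τ : A →L[ℂ] ℂ} (hτ : IsTracialState τ) {x : A}
    (hx : x ∈ commutators A) : τ x = 0 := by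
  have := commutators_le (V := τ.ker) τ.isClosed_ker (fun a b => by
    rw [LinearMap.mem_ker]
    change τ _ = 0
    rw [map_sub, hτ.tracial, sub_self]) hx
  exact this

theorem IsPseudomatricial.trace_one (hA : IsPseudomatricial A)
    {τ : A →L[ℂ] ℂ} (hτ : IsTracialState τ) : τ 1 = 1 := by
  have hnt := hA.nontrivial
  have h1 : 0 ≤ τ 1 := by simpa using hτ.nonneg 1
  -- Modulo commutators $x$ is a scalar of modulus at most $\|x\|$, so $\tau$ attains its norm at
  -- the unit.
  have h2 : ‖τ‖ ≤ ‖τ 1‖ := ContinuousLinearMap.opNorm_le_bound _ (norm_nonneg _) fun x => by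
    obtain ⟨c, hc⟩ := hA.exists_sub_mem x
    have h3 := hτ.apply_eq_zero hc
    rw [map_sub, map_smul, sub_eq_zero] at h3
    rw [h3, norm_smul, mul_comm]
    exact mul_le_mul_of_nonneg_left (hA.norm_le_of_sub_mem hc) (norm_nonneg _)
  have h3 : ‖τ 1‖ ≤ ‖τ‖ := by simpa using τ.le_opNorm 1
  have h4 : ‖τ 1‖ = 1 := (le_antisymm h3 h2).trans hτ.norm_eq_one
  rw [← Complex.norm_of_nonneg' h1, h4]
  simp

theorem IsPseudomatricial.trace_eq (hA : IsPseudomatricial A)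
    {τ : A →L[ℂ] ℂ} (hτ : IsTracialState τ) {x : A} {c : ℂ}
    (h : x - c • 1 ∈ commutators A) : τ x = c := by
  have h3 := hτ.apply_eq_zero h
  rw [map_sub, map_smul, sub_eq_zero, hA.trace_one hτ] at h3
  simpa using h3

theorem IsPseudomatricial.existsUnique_trace (hA : IsPseudomatricial A)
    : ∃! τ : A →L[ℂ] ℂ, IsTracialState τ := by
  have hnt := hA.nontrivial
  choose l hl using hA.exists_sub_mem
  have huniq : ∀ {x : A} {c : ℂ}, x - c • 1 ∈ commutators A → l x = c := fun {x c} h =>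
    hA.eq_of_sub_mem (hl x) h
  let L : A →ₗ[ℂ] ℂ :=
    { toFun := l
      map_add' := fun x y => huniq (by
        have := Submodule.add_mem _ (hl x) (hl y)
        convert this using 1
        rw [add_smul]
        abel)
      map_smul' := fun c x => huniq (by
        have := Submodule.smul_mem _ c (hl x)
        convert this using 1
        rw [smul_sub, smul_smul, RingHom.id_apply, smul_eq_mul]) }
  let τ : A →L[ℂ] ℂ := L.mkContinuous 1 fun x => by
    rw [one_mul]
    exact hA.norm_le_of_sub_mem (hl x)
  have hτl : ∀ x, τ x = l x := fun x => rfl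
  have hone : τ 1 = 1 := huniq (by simp)
  have hstar : ∀ x, τ (star x) = star (τ x) := fun x => huniq (by
    have := star_mem_commutators (hl x)
    rwa [star_sub, star_smul, star_one] at this)
  -- A contractive functional with $\tau(1)=1$ satisfies $|1-\tau(a^*a)|\le1$, since
  -- $\|1-a^*a\|\le1$; the value is real because $K$ is closed under adjoints.
  have hre : ∀ a : A, ‖a‖ ≤ 1 → 0 ≤ τ (star a * a) := fun a ha => by
    have h1 : ‖τ (1 - star a * a)‖ ≤ 1 := by
      have := τ.le_opNorm_of_le (norm_one_sub_star_mul_self_le ha)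
      refine (hA.norm_le_of_sub_mem (hl _)).trans (norm_one_sub_star_mul_self_le ha)
    rw [map_sub, hone] at h1
    have h2 := (Complex.abs_re_le_norm _).trans h1
    rw [Complex.sub_re, Complex.one_re, abs_le] at h2
    have h3 := hstar (star a * a)
    rw [star_mul, star_star] at h3
    have h4 : (τ (star a * a)).im = 0 := Complex.conj_eq_iff_im.mp h3.symm
    exact Complex.nonneg_iff.mpr ⟨by linarith [h2.2], h4.symm⟩
  have hτ : IsTracialState τ := by
    refine ⟨fun a => ?_, ?_, fun a b => ?_⟩
    · by_cases h0 : a = 0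
      · simp [h0]
      · have hn : ‖a‖ ≠ 0 := norm_ne_zero_iff.mpr h0
        have hnC : (‖a‖ : ℂ) ≠ 0 := by exact_mod_cast hn
        have h1 := hre ((‖a‖ : ℂ)⁻¹ • a) (by
          rw [norm_smul, norm_inv, Complex.norm_real, norm_norm, inv_mul_cancel₀ hn])
        have e : star a * a = ((‖a‖ : ℂ) * ‖a‖) •
            (star ((‖a‖ : ℂ)⁻¹ • a) * ((‖a‖ : ℂ)⁻¹ • a)) := by
          rw [star_smul, smul_mul_assoc, mul_smul_comm, smul_smul, smul_smul, star_inv₀,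
            Complex.star_def, Complex.conj_ofReal]
          rw [show (‖a‖ : ℂ) * ‖a‖ * (‖a‖ : ℂ)⁻¹ * (‖a‖ : ℂ)⁻¹ = 1 by field_simp, one_smul]
        rw [e, map_smul, smul_eq_mul]
        refine mul_nonneg ?_ h1
        rw [← Complex.ofReal_mul]
        exact Complex.zero_le_real.mpr (by positivity)
    · refine le_antisymm (L.mkContinuous_norm_le zero_le_one _) ?_
      have := τ.le_opNorm 1
      rwa [hone, norm_one, norm_one, mul_one] at this
    · rw [← sub_eq_zero, ← map_sub]
      exact huniq (by simpa using commutator_mem a b)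
  exact ⟨τ, hτ, fun σ hσ => ContinuousLinearMap.ext fun x => hA.trace_eq hσ (hl x)⟩

theorem IsTracialState.apply_nonneg {τ : A →L[ℂ] ℂ} (hτ : IsTracialState τ) {p : A}
    (hp : IsStarProjection p) : 0 ≤ τ p := by
  have := hτ.nonneg p
  rwa [hp.isSelfAdjoint.star_eq, hp.isIdempotentElem.eq] at this

theorem IsTracialState.re_nonneg {τ : A →L[ℂ] ℂ} (hτ : IsTracialState τ) {p : A}
    (hp : IsStarProjection p) : 0 ≤ (τ p).re := (Complex.nonneg_iff.mp (hτ.apply_nonneg hp)).1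

theorem IsTracialState.eq_of_equiv {τ : A →L[ℂ] ℂ} (hτ : IsTracialState τ) {p q : A}
    (h : MvNEquiv p q) : τ p = τ q := by
  obtain ⟨v, rfl, rfl⟩ := h
  exact hτ.tracial _ _

theorem IsTracialState.le_of_mul_eq {τ : A →L[ℂ] ℂ} (hτ : IsTracialState τ) {p q : A}
    (hp : IsStarProjection p) (hq : IsStarProjection q) (h : q * p = p) :
    (τ p).re ≤ (τ q).re := by
  have := hτ.re_nonneg (hp.sub_of_mul_eq_right hq h)
  rw [map_sub, Complex.sub_re] at this
  linarith

theorem IsTracialState.le_of_mvnLE {τ : A →L[ℂ] ℂ} (hτ : IsTracialState τ) {p q : A}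
    (hp : IsStarProjection p) (hq : IsStarProjection q) (h : MvNLE p q) :
    (τ p).re ≤ (τ q).re := by
  obtain ⟨r, hr, hpr, hqr⟩ := h.exists_equiv hp
  rw [hτ.eq_of_equiv hpr]
  exact hτ.le_of_mul_eq hr hq hqr

theorem IsTracialState.sum_packing {τ : A →L[ℂ] ℂ} (hτ : IsTracialState τ) {n : ℕ} {g p : A}
    {e : Fin n → A} (he : IsPacking g p e) : τ (∑ i, e i) = n * τ g := by
  rw [map_sum, Finset.sum_congr rfl fun i _ => (hτ.eq_of_equiv (he.equiv i)).symm]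
  simp

theorem IsTracialState.sum_packing_re {τ : A →L[ℂ] ℂ} (hτ : IsTracialState τ) {n : ℕ} {g p : A}
    {e : Fin n → A} (he : IsPacking g p e) : (τ (∑ i, e i)).re = n * (τ g).re := by
  rw [hτ.sum_packing he, ← Complex.ofReal_natCast, Complex.re_ofReal_mul]

/-- If finitely many copies of a projection with one-dimensional corner sum up to the unit, then
the algebra is finite-dimensional. -/
theorem finiteDimensional_of_packing {f : A} (hf : IsStarProjection f)
    (hfc : ∀ x : A, ∃ c : ℂ, f * x * f = c • f) {N : ℕ} {e : Fin N → A} (he : IsPacking f 1 e)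
    (hsum : ∑ i, e i = 1) : FiniteDimensional ℂ A := by
  choose w hw1 hw2 using he.equiv
  have hwf : ∀ i, w i * f = w i := fun i => by
    rw [← hw1 i]
    exact mul_star_mul_self (by rw [hw1]; exact hf)
  have hwf' : ∀ i, f * star (w i) = star (w i) := fun i => by
    have := congrArg star (hwf i)
    rwa [star_mul, hf.isSelfAdjoint.star_eq] at this
  refine Module.finite_def.mpr ?_
  have htop : (⊤ : Submodule ℂ A) =
      Submodule.span ℂ (Set.range fun i : Fin N × Fin N => w i.1 * star (w i.2)) := by
    refine (eq_top_iff.mpr fun x _ => ?_).symm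
    have e1 : x = ∑ i, ∑ j, e i * x * e j := by
      simp only [← Finset.mul_sum, ← Finset.sum_mul, hsum, one_mul, mul_one]
    rw [e1]
    refine Submodule.sum_mem _ fun i _ => Submodule.sum_mem _ fun j _ => ?_
    obtain ⟨c, hc⟩ := hfc (star (w i) * x * w j)
    -- The $w_iw_j^*$ are matrix units: each block of $x$ passes through the one-dimensional corner
    -- of $f$.
    have e2 : e i * x * e j = c • (w i * star (w j)) := by
      calc e i * x * e j = w i * (star (w i) * x * w j) * star (w j) := by
            rw [← hw2, ← hw2]
            simp only [mul_assoc]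
        _ = w i * (f * (star (w i) * x * w j) * f) * star (w j) := by
            have : ∀ y, w i * (f * y * f) * star (w j) = w i * f * y * (f * star (w j)) :=
              fun y => by simp only [mul_assoc]
            rw [this, hwf, hwf']
        _ = c • (w i * star (w j)) := by
            rw [hc, mul_smul_comm, smul_mul_assoc, hwf]
    rw [e2]
    exact Submodule.smul_mem _ _ (Submodule.subset_span ⟨(i, j), rfl⟩)
  rw [htop]
  exact Submodule.fg_span (Set.finite_range _)

/-- A cover and a packing give $\tau(p)\le m\,\tau(q)\le m/n$. Conversely, covering $p$ by copies of
a projection of trace $1/n$ overshoots by at most $1/n$; if finitely many copies of $f$ fill the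
unit, copies of $f$ cover $p$ exactly and the infimum is attained. -/
theorem IsPseudomatricial.isGLB_trace (hA : IsPseudomatricial A)
    {τ : A →L[ℂ] ℂ} (hτ : IsTracialState τ) {p : A}
    (hp : IsStarProjection p) :
    IsGLB {t : ℝ | ∃ (m n : ℕ) (q : A), 1 ≤ n ∧ IsStarProjection q ∧
      HasOrthogonalCopies n q ∧ IsCoveredByCopies m q p ∧ t = (m : ℝ) / n} (τ p).re := by
  have hone := hA.trace_one hτ
  have hcov : ∀ {j : ℕ} {g : A} {e : Fin j → A}, IsPacking g p e → IsStarProjection g →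
      MvNLE (p - ∑ i, e i) g → IsCoveredByCopies (j + 1) g p := fun {j g e} he hg hle => by
    have hr := he.isStarProjection_sub hp
    have hS := he.isStarProjection_sum
    have hrS : ∀ i, (p - ∑ i, e i) * e i = 0 := fun i => by
      rw [sub_mul, he.le, Finset.sum_mul, Finset.sum_eq_single i
        (fun j _ hj => he.orth j i hj) (by simp), (he.proj i).isIdempotentElem.eq, sub_self]
    refine ⟨Fin.cons (p - ∑ i, e i) e, fun i => ?_, fun i j => ?_, fun i => ?_, ?_⟩
    · refine Fin.cases ?_ (fun i => ?_) i
      · exact hr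
      · exact he.proj i
    · refine Fin.cases ?_ (fun i => ?_) i <;> refine Fin.cases ?_ (fun j => ?_) j
      · simp
      · intro _
        exact hrS j
      · intro _
        exact IsStarProjection.mul_eq_zero_comm hr (he.proj i) (hrS i)
      · intro hij
        exact he.orth i j fun hh => hij (by rw [hh])
    · refine Fin.cases ?_ (fun i => ?_) i
      · exact hle
      · exact (he.equiv i).symm.mvnLE hg.isIdempotentElem.eq
    · rw [Fin.sum_univ_succ]
      simp
  constructor
  · rintro _ ⟨m, n, q, hn, hq, hcop, ⟨e, he, -, hle, hsum⟩, rfl⟩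
    obtain ⟨e', he'⟩ := hcop.exists_isPacking
    have hn0 : (0 : ℝ) < n := by exact_mod_cast hn
    have h1 : n * (τ q).re ≤ 1 := by
      rw [← hτ.sum_packing_re he']
      have := hτ.le_of_mul_eq he'.isStarProjection_sum (.one A) (one_mul _)
      rwa [hone, Complex.one_re] at this
    have h2 : (τ p).re ≤ m * (τ q).re := by
      rw [hsum, map_sum, Complex.re_sum]
      refine (Finset.sum_le_card_nsmul _ _ (τ q).re fun i _ =>
        hτ.le_of_mvnLE (he i) hq (hle i)).trans (by simp)
    rw [le_div_iff₀ hn0]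
    have h3 : (0 : ℝ) ≤ m := Nat.cast_nonneg m
    nlinarith
  · intro t ht
    obtain ⟨f, hf, hfc⟩ := hA.exists_isMinimalProjection
    by_cases hinf : ∀ n, HasOrthogonalCopies n f
    · refine le_of_forall_pos_lt_add fun ε hε => ?_
      obtain ⟨n, hn⟩ := exists_nat_one_div_lt hε
      obtain ⟨q, hq, hqc, hq1⟩ := hA.approxFraction_one hf hinf (n := n + 1) (by omega)
      obtain ⟨j, e, he, hle⟩ := hA.exists_multiple (by omega) hq hq1 hp
      have h1 : t ≤ ((j + 1 : ℕ) : ℝ) / ((n + 1 : ℕ) : ℝ) :=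
        ht ⟨j + 1, n + 1, q, by omega, hq, hqc, hcov he hq hle, rfl⟩
      have h2 := hτ.le_of_mul_eq he.isStarProjection_sum hp he.mul_sum
      rw [hτ.sum_packing_re he] at h2
      have h3 : ((n : ℝ) + 1) * (τ q).re = 1 := by
        have := hτ.apply_eq_zero hq1
        rw [map_sub, map_smul, hone, sub_eq_zero, smul_eq_mul, ← Complex.ofReal_natCast] at this
        have := congrArg Complex.re this
        rw [Complex.re_ofReal_mul, Complex.one_re] at this
        push_cast at this
        exact this
      have h4 : (0 : ℝ) < n + 1 := by positivity
      have h5 : (τ q).re = 1 / (n + 1) := by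
        rw [eq_div_iff h4.ne', mul_comm, h3]
      rw [h5] at h2
      push_cast at h1
      rw [add_div] at h1
      have h6 : (j : ℝ) * (1 / (n + 1)) = j / (n + 1) := by ring
      linarith
    · obtain ⟨N, e, he, hsum⟩ := hA.exists_packing_eq_one hf hinf
      have := hA.nontrivial
      have hN : 1 ≤ N := by
        rcases Nat.eq_zero_or_pos N with rfl | h
        · simp at hsum
        · exact h
      have hN0 : (0 : ℝ) < N := by exact_mod_cast hN
      have hf1 : (N : ℂ) • f - 1 ∈ commutators A := hsum ▸ he.smul_sub_sum_mem
      have h3 : (N : ℝ) * (τ f).re = 1 := by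
        rw [← hτ.sum_packing_re he, hsum, hone, Complex.one_re]
      obtain ⟨j, e', he', hle⟩ := hA.exists_multiple hN hf.1 hf1 hp
      obtain ⟨m, hm, hpm⟩ : ∃ m : ℕ, IsCoveredByCopies m f p ∧ (τ p).re = m * (τ f).re := by
        have hpS : (τ p).re = j * (τ f).re + (τ (p - ∑ i, e' i)).re := by
          rw [map_sub, Complex.sub_re, hτ.sum_packing_re he']
          ring
        rcases hf.equiv_or_eq_zero (he'.isStarProjection_sub hp) hle with h | h
        · refine ⟨j, ⟨e', he'.proj, he'.orth, fun i =>
            (he'.equiv i).symm.mvnLE hf.1.isIdempotentElem.eq, sub_eq_zero.mp h⟩, ?_⟩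
          rw [hpS, h]
          simp
        · refine ⟨j + 1, hcov he' hf.1 hle, ?_⟩
          rw [hpS, ← hτ.eq_of_equiv h]
          push_cast
          ring
      have h1 : t ≤ (m : ℝ) / N := ht ⟨m, N, f, hN, hf.1, he.hasOrthogonalCopies, hm, rfl⟩
      have h5 : (τ f).re = 1 / N := by rw [eq_div_iff hN0.ne', mul_comm, h3]
      rw [hpm, h5, mul_one_div]
      exact h1

theorem IsPseudomatricial.trace_of_isApproxFraction (hA : IsPseudomatricial A)
    {τ : A →L[ℂ] ℂ} (hτ : IsTracialState τ)
    (hfin : ¬ FiniteDimensional ℂ A) {p q : A} {d : ℕ} (h : IsApproxFraction d q p) :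
    τ q = τ p / d := by
  obtain ⟨k, e, m, hk, he, hm, heo, -, -, hqe, -, rfl⟩ := h
  obtain ⟨f, hf, hfc⟩ := hA.exists_isMinimalProjection
  -- In infinite dimension $f$ must have arbitrarily many copies. Then minimal projections have
  -- trace zero, and the remainders do not contribute.
  have hinf : ∀ n, HasOrthogonalCopies n f := by
    by_contra hcon
    obtain ⟨N, e', he', hsum⟩ := hA.exists_packing_eq_one hf hcon
    exact hfin (finiteDimensional_of_packing hf.1 hfc he' hsum)
  have hf0 := hτ.apply_eq_zero (mem_commutators_of_forall_copies hinf)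
  have hd : (d : ℂ) ≠ 0 := by exact_mod_cast (by omega : d ≠ 0)
  have hpack : IsPacking q 1 e := ⟨he, heo, hqe, fun i => one_mul _⟩
  rw [map_add, hτ.sum_packing hpack, map_sum, Finset.sum_eq_zero fun j _ => by
    rw [← hτ.eq_of_equiv (hA.equiv_of_isMinimalProjection hf (hm j)), hf0], add_zero,
    mul_div_cancel_left₀ _ hd]

theorem IsPseudomatricial.trace_properties (hA : IsPseudomatricial A) :
    (∃! τ : A →L[ℂ] ℂ, IsTracialState τ) ∧
    closure (Submodule.span ℂ {p : A | IsStarProjection p} : Set A) = Set.univ ∧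
    ∀ τ : A →L[ℂ] ℂ, IsTracialState τ → ∀ p : A, IsStarProjection p →
      (∀ n : ℕ, HasOrthogonalCopies n p → n * (τ p).re ≤ 1) ∧
      (∀ n : ℕ, ¬ HasOrthogonalCopies (n + 1) p → 1 ≤ (n + 1) * (τ p).re) ∧
      (∀ d : ℕ, 1 ≤ d → ∃ q : A, IsApproxFraction d q p) ∧
      (¬ FiniteDimensional ℂ A → ∀ (d : ℕ) (q : A), IsApproxFraction d q p → τ q = τ p / d) ∧
      IsGLB {t : ℝ | ∃ (m n : ℕ) (q : A), 1 ≤ n ∧ IsStarProjection q ∧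
        HasOrthogonalCopies n q ∧ IsCoveredByCopies m q p ∧ t = (m : ℝ) / n} (τ p).re := by
  refine ⟨hA.existsUnique_trace, hA.closure_span_projections, fun τ hτ p hp =>
    ⟨fun n hn => ?_, fun n hn => ?_, fun d hd => ?_,
      fun hfin d q h => hA.trace_of_isApproxFraction hτ hfin h, hA.isGLB_trace hτ hp⟩⟩
  · obtain ⟨e, he⟩ := hn.exists_isPacking
    have := hτ.le_of_mul_eq he.isStarProjection_sum (.one A) (one_mul _)
    rwa [hτ.sum_packing_re he, hA.trace_one hτ, Complex.one_re] at this
  · rcases hA.exists_packing hp (.one A) (n + 1) with ⟨e, he⟩ | ⟨j, hj, e, he, hle⟩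
    · exact absurd he.hasOrthogonalCopies hn
    · have h1 := hτ.le_of_mvnLE (he.isStarProjection_sub (.one A)) hp hle
      rw [map_sub, Complex.sub_re, hτ.sum_packing_re he, hA.trace_one hτ, Complex.one_re] at h1
      have h2 : (j : ℝ) ≤ n := by exact_mod_cast Nat.lt_succ_iff.mp hj
      have h3 := hτ.re_nonneg hp
      nlinarith
  · obtain ⟨f, hf, -⟩ := hA.exists_isMinimalProjection
    exact hA.exists_isApproxFraction hp hf hd

end Trace

/-- A non-unital C*-algebra with a two-sided unit is a C*-algebra. -/
abbrev cstarAlgebraOfUnit {A : Type*} [NonUnitalCStarAlgebra A] (e : A)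
    (he : ∀ y, e * y = y ∧ y * e = y) : CStarAlgebra A :=
  letI R : NormedRing A :=
    { ‹NonUnitalCStarAlgebra A›.toNonUnitalNormedRing with
      one := e
      one_mul := fun y => (he y).1
      mul_one := fun y => (he y).2 }
  letI : NormedAlgebra ℂ A :=
    { Algebra.ofModule (fun c x y => smul_mul_assoc c x y) (fun c x y => mul_smul_comm c x y) with
      norm_smul_le := fun c x => norm_smul_le c x }
  { toNormedRing := R
    toStarRing := ‹NonUnitalCStarAlgebra A›.toStarRing
    toCompleteSpace := ‹NonUnitalCStarAlgebra A›.toCompleteSpace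
    toCStarRing := ‹NonUnitalCStarAlgebra A›.toCStarRing
    toNormedAlgebra := inferInstance
    toStarModule := ‹NonUnitalCStarAlgebra A›.toStarModule }

end ContLogic

theorem proposition6p5 {A : Type*} [NonUnitalCStarAlgebra A]
    (hA : ContLogic.IsPseudomatricial A) :
    (∃! τ : A →L[ℂ] ℂ, ContLogic.IsTracialState τ) ∧
    closure (Submodule.span ℂ {p : A | IsStarProjection p} : Set A) = Set.univ ∧
    ∀ τ : A →L[ℂ] ℂ, ContLogic.IsTracialState τ → ∀ p : A, IsStarProjection p →
      (∀ n : ℕ, ContLogic.HasOrthogonalCopies n p → n * (τ p).re ≤ 1) ∧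
      (∀ n : ℕ, ¬ ContLogic.HasOrthogonalCopies (n + 1) p → 1 ≤ (n + 1) * (τ p).re) ∧
      (∀ d : ℕ, 1 ≤ d → ∃ q : A, ContLogic.IsApproxFraction d q p) ∧
      (¬ FiniteDimensional ℂ A → ∀ (d : ℕ) (q : A), ContLogic.IsApproxFraction d q p →
        τ q = τ p / d) ∧
      IsGLB {t : ℝ | ∃ (m n : ℕ) (q : A), 1 ≤ n ∧ IsStarProjection q ∧
        ContLogic.HasOrthogonalCopies n q ∧ ContLogic.IsCoveredByCopies m q p ∧
        t = (m : ℝ) / n} (τ p).re := by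
  obtain ⟨e, -, he⟩ := hA.exists_unit
  -- The unital structure is built on the given operations, star and norm, so both statements agree
  -- definitionally.
  exact @ContLogic.IsPseudomatricial.trace_properties A (ContLogic.cstarAlgebraOfUnit e he) hA
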